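/- Let $E$ be a finite-dimensional real normed space (for example $\mathbb{R}^k$), and let $\{X_s, s\in\mathbb{R}^2\}$ be a strictly stationary $E$-valued random field, such that $(s,\omega)\mapsto X_s(\omega)$ is measurable with respect to $\mathcal{B}(\mathbb{R}^2)\otimes\sigma(X_s,s\in\mathbb{R}^2)$. Assume that $X$ is regularly varying with index $\alpha>0$: there are $a_n\to\infty$ and, for every non-empty finite $H\subset\mathbb{R}^2$, a non-null Radon measure $\mu_H$ on $E^H\setminus\{0\}$ (finite on sets bounded away from $0$) with $\mu_H(c\,\cdot)=c^{-\alpha}\mu_H(\cdot)$ for $c>0$ and $nP(a_n^{-1}X_H\in\cdot)\to\mu_H$ vaguely (tested on bounded continuous functions vanishing near $0$). Let $(a_n)$ be normalized by $nP(|X_0|>a_n)\to1$ and write $\mu=\mu_{\{0\}}$. Let $N$ be a homogeneous Poisson point process on $\mathbb{R}^2$ with intensity $\nu>0$, independent of $X$. Let $S_n\subset\mathbb{R}^2$ be compact convex sets with Lebesgue measure $|S_n|\to\infty$ and $|S_n\cap(S_n-y)|/|S_n|\to1$ for every $y\in\mathbb{R}^2$. Let $A\subset E$ be a Borel set bounded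 away from $0$ with $\mu(\partial A)=0$, and let $m=m_n$ be a nondecreasing sequence of nonnegative integers with $m_n\to\infty$. Put $$p_m(A)=m_nP(X_0/a_{m}\in A),\qquad \tau_{AA,m}(y)=m_nP(X_0/a_m\in A,\,X_y/a_m\in A),\qquad \tau_{AA}(y)=\lim_{n\to\infty}\tau_{AA,m}(y),$$ $$\hat p_m(A)=\frac{m_n}{\nu|S_n|}\int_{S_n}\mathbf 1\{X_s/a_m\in A\}\,N(ds).$$ Let $\alpha_{1,1}(\rho)$ be the supremum of $|P(U\cap V)-P(U)P(V)|$ over $U\in\sigma(X_s)$, $V\in\sigma(X_t)$ and $s,t\in\mathbb{R}^2$ with $|s-t|\ge\rho$. Assume condition (M2): $m_n=o(n)$ and there are real $r_n$ with $r_n^2=o(m_n)$ such that $$\lim_{k\to\infty}\limsup_{n\to\infty}\int_{k\le|y|\le r_n}m_nP(|X_y|>\epsilon a_m,\ |X_0|>\epsilon a_m)\,dy=0\quad\text{for all }\epsilon>0,$$ $$\lim_{n\to\infty}\int_{|y|\ge r_n}m_n\,\alpha_{1,1}(|y|)\,dy=0,\qquad \int_{\mathbb{R}^2}\tau_{AA}(y)\,dy<\infty.$$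 Then $\hat p_m(A)$ is square integrable for every $n$, $E\hat p_m(A)=p_m(A)$ whenever $|S_n|>0$, and $$p_m(A)\to\mu(A),\qquad \frac{|S_n|}{m_n}\operatorname{var}(\hat p_m(A))\to\frac{\mu(A)}{\nu}+\int_{\mathbb{R}^2}\tau_{AA}(y)\,dy .$$ Hence, if in addition $m_n=o(|S_n|)$, then $\hat p_m(A)\to\mu(A)$ in probability. -/

import Mathlib

open MeasureTheory ProbabilityTheory Filter Topology Asymptotics
open scoped NNReal ENNReal Pointwise

namespace SpatialExtremogram

noncomputable section

/-- The Euclidean plane `ℝ²`, with its Euclidean norm and Lebesgue measure `volume`. -/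
abbrev Plane : Type := EuclideanSpace ℝ (Fin 2)

/-- The σ-algebra `σ(X_s : s ∈ S)` generated by the field on a set `S` of sites. -/
def fieldSigma {Ω E : Type*} [MeasurableSpace E] (X : Plane → Ω → E) (S : Set Plane) :
    MeasurableSpace Ω :=
  ⨆ s ∈ S, MeasurableSpace.comap (X s) inferInstance

/-- `X` is a measurable random field on `(Ω, P)`: each `X_s` is a random variable, and
`(s, ω) ↦ X_s(ω)` is jointly measurable for `Borel(ℝ²) ⊗ σ(X)`. Joint measurability with respect
to the σ-algebra generated by the field itself (and not just with respect to that of `Ω`) is what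
makes "`X` independent of the sampling locations" meaningful when `X` is evaluated at random
sites. It holds, for instance, for every field with continuous paths. -/
structure IsMeasurableField {Ω E : Type*} [MeasurableSpace Ω] [MeasurableSpace E]
    (X : Plane → Ω → E) : Prop where
  measurable : ∀ s, Measurable (X s)
  joint : @Measurable (Plane × Ω) E
    (@Prod.instMeasurableSpace Plane Ω inferInstance (fieldSigma X Set.univ)) inferInstance
    (fun p => X p.1 p.2)

/-- Strict stationarity: all finite-dimensional distributions are invariant under shifts. -/
def IsStationary {Ω E : Type*} [MeasurableSpace Ω] [MeasurableSpace E]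
    (P : Measure Ω) (X : Plane → Ω → E) : Prop :=
  ∀ (H : Finset Plane) (h : Plane),
    P.map (fun ω (s : H) => X (s + h) ω) = P.map (fun ω (s : H) => X s ω)

/-- The random field `X` is regularly varying with index `α`, normalizing sequence `a n → ∞` and
limit measures `μ H` (`H` a non-empty finite set of sites): `μ H` is a non-null Radon measure on
the punctured space `E^H \ {0}`, homogeneous of order `-α`, and `n P(X_H / a n ∈ ·)` converges
vaguely to `μ H`.

Measures on the punctured space are represented by measures on `E^H` without mass at `0` that are
finite away from `0`. The relatively compact sets of the punctured compactified space are the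
sets bounded away from `0`, and homogeneity excludes mass at infinity, so vague
convergence is tested on bounded continuous functions that vanish near `0`. -/
structure IsRegularlyVarying {Ω E : Type*} [MeasurableSpace Ω] [NormedAddCommGroup E]
    [NormedSpace ℝ E] [MeasurableSpace E] (P : Measure Ω) (X : Plane → Ω → E) (α : ℝ)
    (a : ℕ → ℝ) (μ : (H : Finset Plane) → Measure (H → E)) : Prop where
  index_pos : 0 < α
  tendsto_norm : Tendsto a atTop atTop
  ne_zero : ∀ H : Finset Plane, H.Nonempty → μ H ≠ 0
  zero : ∀ H : Finset Plane, H.Nonempty → μ H {0} = 0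
  finite : ∀ H : Finset Plane, H.Nonempty → ∀ r : ℝ, 0 < r → μ H {x | r ≤ ‖x‖} < ∞
  homogeneous : ∀ H : Finset Plane, H.Nonempty → ∀ c : ℝ, 0 < c → ∀ B : Set (H → E),
    MeasurableSet B → μ H (c • B) = ENNReal.ofReal (c ^ (-α)) * μ H B
  vague : ∀ H : Finset Plane, H.Nonempty → ∀ f : BoundedContinuousFunction (H → E) ℝ,
    (∀ᶠ x in 𝓝 (0 : H → E), f x = 0) →
      Tendsto (fun n : ℕ => (n : ℝ) * ∫ ω, f (fun s : H => (a n)⁻¹ • X s ω) ∂P) atTop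
        (𝓝 (∫ x, f x ∂(μ H)))

/-- The one-site limit measure: `μ_{{0}}`, seen as a measure on `E` instead of `E^{{0}}`. -/
def oneSite {E : Type*} [MeasurableSpace E]
    (μ : (H : Finset Plane) → Measure (H → E)) : Measure E :=
  (μ {0}).map (fun x => x ⟨0, Finset.mem_singleton_self 0⟩)

/-- `N` is a homogeneous Poisson point process on the plane with intensity `ν`: a random measure,
integer-valued on bounded sets, with Poisson counts that are independent over disjoint sets. -/
structure IsPoissonProcess {Ω : Type*} [MeasurableSpace Ω] (P : Measure Ω)
    (N : Ω → Measure Plane) (ν : ℝ≥0) : Prop where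
  measurable : Measurable N
  count : ∀ ω, ∀ B : Set Plane, MeasurableSet B → Bornology.IsBounded B →
    ∃ j : ℕ, N ω B = j
  law : ∀ B : Set Plane, MeasurableSet B → Bornology.IsBounded B → ∀ j : ℕ,
    P {ω | N ω B = j} = poissonMeasure (ν * (volume B).toNNReal) {j}
  indep : ∀ (k : ℕ) (B : Fin k → Set Plane),
    (∀ i, MeasurableSet (B i)) → (∀ i, Bornology.IsBounded (B i)) →
    Pairwise (fun i j => Disjoint (B i) (B j)) → iIndepFun (fun i ω => N ω (B i)) P

/-- The mixing coefficient `α_{j,k}(r)`: the supremum of `|P(U ∩ V) - P(U) P(V)|` over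
`U ∈ σ(X_s : s ∈ S)`, `V ∈ σ(X_s : s ∈ T)` and sets `S`, `T` of at most `j` and at most `k` sites
at distance at least `r`. -/
def mixingCoeff {Ω E : Type*} [MeasurableSpace Ω] [MeasurableSpace E]
    (P : Measure Ω) (X : Plane → Ω → E) (j k : ℕ) (r : ℝ) : ℝ :=
  sSup {x | ∃ S T : Finset Plane, S.card ≤ j ∧ T.card ≤ k ∧
    (∀ s ∈ S, ∀ t ∈ T, r ≤ dist s t) ∧
    ∃ U V : Set Ω, MeasurableSet[fieldSigma X S] U ∧ MeasurableSet[fieldSigma X T] V ∧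
      x = |P.real (U ∩ V) - P.real U * P.real V|}

/-- `p_m(A) = m P(X_0 / a_m ∈ A)`. -/
def pPre {Ω E : Type*} [MeasurableSpace Ω] [NormedAddCommGroup E] [NormedSpace ℝ E]
    (P : Measure Ω) (X : Plane → Ω → E) (a : ℕ → ℝ) (A : Set E) (m : ℕ) : ℝ :=
  m * P.real {ω | (a m)⁻¹ • X 0 ω ∈ A}

/-- `τ_{AB,m}(h) = m P(X_0 / a_m ∈ A, X_h / a_m ∈ B)`. -/
def tauPre {Ω E : Type*} [MeasurableSpace Ω] [NormedAddCommGroup E] [NormedSpace ℝ E]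
    (P : Measure Ω) (X : Plane → Ω → E) (a : ℕ → ℝ) (A B : Set E) (m : ℕ) (h : Plane) : ℝ :=
  m * P.real {ω | (a m)⁻¹ • X 0 ω ∈ A ∧ (a m)⁻¹ • X h ω ∈ B}

/-- `τ_{AB}(h) = lim_n τ_{AB,m_n}(h)`. -/
def tau {Ω E : Type*} [MeasurableSpace Ω] [NormedAddCommGroup E] [NormedSpace ℝ E]
    (P : Measure Ω) (X : Plane → Ω → E) (a : ℕ → ℝ) (m : ℕ → ℕ) (A B : Set E) (h : Plane) : ℝ :=
  limUnder atTop (fun n : ℕ => tauPre P X a A B (m n) h)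

/-- The estimator `p̂_m(A) = m / (ν |S|) ∫_S 1(X_s / a_m ∈ A) N(ds)` from the points in `S`. -/
def pHat {Ω E : Type*} [NormedAddCommGroup E] [NormedSpace ℝ E]
    (X : Plane → Ω → E) (N : Ω → Measure Plane) (ν : ℝ≥0) (a : ℕ → ℝ) (A : Set E)
    (S : Set Plane) (m : ℕ) (ω : Ω) : ℝ :=
  (m : ℝ) / ((ν : ℝ) * volume.real S) *
    ∫ s in S, A.indicator (fun _ => (1 : ℝ)) ((a m)⁻¹ • X s ω) ∂(N ω)

/-- Condition (M2) for the sequences `m`, `r` and the set `A`: growth of `m` and `r`, joint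
exceedances at intermediate distances are negligible, mixing at large distances, and `τ_AA` is
integrable. The integrals of nonnegative functions are Lebesgue integrals in `[0, ∞]`. -/
structure ConditionM2 {Ω E : Type*} [MeasurableSpace Ω] [NormedAddCommGroup E]
    [NormedSpace ℝ E] [MeasurableSpace E] (P : Measure Ω) (X : Plane → Ω → E) (a : ℕ → ℝ)
    (m : ℕ → ℕ) (r : ℕ → ℝ) (A : Set E) : Prop where
  mono : Monotone m
  m_littleO : (fun n => (m n : ℝ)) =o[atTop] (fun n : ℕ => (n : ℝ))
  r_littleO : (fun n => r n ^ 2) =o[atTop] (fun n => (m n : ℝ))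
  anticlustering : ∀ ε : ℝ, 0 < ε →
    Tendsto (fun k : ℕ => limsup (fun n : ℕ =>
      ∫⁻ y in {y : Plane | (k : ℝ) ≤ ‖y‖ ∧ ‖y‖ ≤ r n},
        (m n : ℝ≥0∞) * P {ω | ε * a (m n) < ‖X y ω‖ ∧ ε * a (m n) < ‖X 0 ω‖}) atTop)
      atTop (𝓝 0)
  mixing : Tendsto (fun n : ℕ => ∫⁻ y in {y : Plane | r n ≤ ‖y‖},
      (m n : ℝ≥0∞) * ENNReal.ofReal (mixingCoeff P X 1 1 ‖y‖)) atTop (𝓝 0)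
  tau_integral : ∫⁻ y : Plane, ENNReal.ofReal (tau P X a m A A y) < ∞

end

end SpatialExtremogram

namespace SpatialExtremogram

/-! ### Poisson counts: first and second moments. -/

section

/-! The estimator is a constant times the integral over `S` of an indicator of the field against an
independent Poisson process. The second moment measure of that process is `ν²` times the product of
Lebesgue measures plus `ν` times Lebesgue measure on the diagonal
(`IsPoissonProcess.lintegral_window_sq`). By stationarity the double integral over `S × S` depends
only on `y = t - s`, each `y` being weighted by `|S ∩ (S - y)|`. Normalizing gives the exact
identity `variance_pHat`: `|S|/m · var` equals `p_m/ν + ∫ (τ_m(y) - p_m²/m) |S ∩ (S - y)|/|S| dy`.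

Regular variation gives the pointwise limits. The first term tends to `μ(A)/ν` and the integrand to
`τ(y)`, because `p_m²/m → 0` and the weight tends to 1. For `τ_m` one needs `A × A` to be a
continuity set of the two-site limit measure, which follows from the one-site condition because
stationarity identifies all one-site marginals away from 0.

What remains is to exchange limit and integral (`tendsto_integral_covariance`). Convergence holds in
`L¹`, by splitting the plane into three zones. On a fixed ball, `τ_m ≤ p_m` allows dominated
convergence. For `k ≤ |y| ≤ r_n`, anticlustering makes `∫ τ_m` small, and the centring `p_m²/m`
integrates to at most a constant times `r_n²/m → 0`. For `|y| ≥ r_n`, the covariance is at most `m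
α_{1,1}(|y|)`. Outside the ball the limit `τ` itself has a small integral.

If `m = o(|S|)`, the variance tends to 0 and Chebyshev's inequality gives consistency. -/

lemma poissonMeasure_succ (r : ℝ≥0) (j : ℕ) :
    ((j : ℝ≥0∞) + 1) * poissonMeasure r {j + 1} = r * poissonMeasure r {j} := by
  rw [poissonMeasure_singleton, poissonMeasure_singleton,
    show ((j : ℝ≥0∞) + 1) = ENNReal.ofReal ((j : ℝ) + 1) by
      rw [ENNReal.ofReal_add (by positivity) zero_le_one]; simp,
    show (r : ℝ≥0∞) = ENNReal.ofReal r by simp,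
    ← ENNReal.ofReal_mul (by positivity), ← ENNReal.ofReal_mul (by positivity)]
  congr 1
  rw [Nat.factorial_succ]
  push_cast
  field_simp
  ring

lemma lintegral_poissonMeasure_id (r : ℝ≥0) : ∫⁻ j : ℕ, (j : ℝ≥0∞) ∂(poissonMeasure r) = r := by
  have hsum : ∑' j : ℕ, poissonMeasure r {j} = 1 := by
    have := lintegral_countable' (μ := poissonMeasure r) (fun _ : ℕ => (1 : ℝ≥0∞))
    simpa using this.symm
  rw [lintegral_countable', tsum_eq_zero_add' ENNReal.summable]
  simp only [Nat.cast_zero, zero_mul, zero_add, Nat.cast_add, Nat.cast_one, poissonMeasure_succ]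
  rw [ENNReal.tsum_mul_left, hsum, mul_one]

lemma lintegral_poissonMeasure_sq (r : ℝ≥0) :
    ∫⁻ j : ℕ, (j : ℝ≥0∞) * j ∂(poissonMeasure r) = r * r + r := by
  have hsum : ∑' j : ℕ, poissonMeasure r {j} = 1 := by
    have := lintegral_countable' (μ := poissonMeasure r) (fun _ : ℕ => (1 : ℝ≥0∞))
    simpa using this.symm
  have h1 := lintegral_poissonMeasure_id r
  rw [lintegral_countable'] at h1
  rw [lintegral_countable', tsum_eq_zero_add' ENNReal.summable]
  simp only [Nat.cast_zero, zero_mul, zero_add, Nat.cast_add, Nat.cast_one, mul_assoc,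
    poissonMeasure_succ]
  have : ∀ j : ℕ, ((j : ℝ≥0∞) + 1) * (r * poissonMeasure r {j}) =
      r * (j * poissonMeasure r {j}) + r * poissonMeasure r {j} := fun j => by ring
  simp_rw [this]
  rw [ENNReal.tsum_add, ENNReal.tsum_mul_left, ENNReal.tsum_mul_left, h1, hsum, mul_one]

variable {Ω : Type*} [MeasurableSpace Ω] {P : Measure Ω} {N : Ω → Measure Plane} {ν : ℝ≥0}

namespace IsPoissonProcess

lemma measurable_count (hN : IsPoissonProcess P N ν) {B : Set Plane} (hB : MeasurableSet B) :
    Measurable fun ω => N ω B :=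
  (Measure.measurable_coe hB).comp hN.measurable

/-- Counts take values in `ℝ≥0∞` but are integers at every `ω`, so the floor of the real part loses
nothing and has a Poisson law on `ℕ`. Moments of counts become Poisson series. -/
lemma lintegral_count_comp [IsProbabilityMeasure P] (hN : IsPoissonProcess P N ν) {B : Set Plane}
    (hB : MeasurableSet B) (hb : Bornology.IsBounded B) (φ : ℝ≥0∞ → ℝ≥0∞) :
    ∫⁻ ω, φ (N ω B) ∂P = ∫⁻ j : ℕ, φ j ∂(poissonMeasure (ν * (volume B).toNNReal)) := by
  set c : Ω → ℕ := fun ω => ⌊(N ω B).toReal⌋₊ with hc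
  have hcm : Measurable c := Nat.measurable_floor.comp (hN.measurable_count hB).ennreal_toReal
  have hce : ∀ ω, N ω B = c ω := fun ω => by
    obtain ⟨j, hj⟩ := hN.count ω B hB hb
    simp [hc, hj]
  have hmap : P.map c = poissonMeasure (ν * (volume B).toNNReal) := by
    refine Measure.ext_of_singleton fun j => ?_
    rw [Measure.map_apply hcm (measurableSet_singleton j), ← hN.law B hB hb j]
    congr 1
    ext ω
    simp [hce]
  rw [← hmap, lintegral_map (measurable_of_countable _) hcm]
  simp_rw [hce]

lemma coe_mean {B : Set Plane} (hb : Bornology.IsBounded B) :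
    ((ν * (volume B).toNNReal : ℝ≥0) : ℝ≥0∞) = ν * volume B := by
  rw [ENNReal.coe_mul, ENNReal.coe_toNNReal hb.measure_lt_top.ne]

lemma lintegral_count [IsProbabilityMeasure P] (hN : IsPoissonProcess P N ν) {B : Set Plane}
    (hB : MeasurableSet B) (hb : Bornology.IsBounded B) :
    ∫⁻ ω, N ω B ∂P = ν * volume B := by
  rw [hN.lintegral_count_comp hB hb (fun x => x), lintegral_poissonMeasure_id, coe_mean hb]

lemma lintegral_count_sq [IsProbabilityMeasure P] (hN : IsPoissonProcess P N ν) {B : Set Plane}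
    (hB : MeasurableSet B) (hb : Bornology.IsBounded B) :
    ∫⁻ ω, N ω B * N ω B ∂P = (ν * volume B) * (ν * volume B) + ν * volume B := by
  rw [hN.lintegral_count_comp hB hb (fun x => x * x), lintegral_poissonMeasure_sq, coe_mean hb]

lemma lintegral_count_mul_of_disjoint [IsProbabilityMeasure P] (hN : IsPoissonProcess P N ν)
    {B C : Set Plane} (hB : MeasurableSet B) (hb : Bornology.IsBounded B)
    (hC : MeasurableSet C) (hc : Bornology.IsBounded C) (hd : Disjoint B C) :
    ∫⁻ ω, N ω B * N ω C ∂P = (ν * volume B) * (ν * volume C) := by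
  have hind := hN.indep 2 ![B, C] (by simp [Fin.forall_fin_two, hB, hC])
    (by simp [Fin.forall_fin_two, hb, hc])
    (by
      intro i j hij
      fin_cases i <;> fin_cases j <;> simp_all [disjoint_comm])
  have h2 : IndepFun (fun ω => N ω B) (fun ω => N ω C) P := by
    simpa using hind.indepFun (i := 0) (j := 1) (by decide)
  have := lintegral_mul_eq_lintegral_mul_lintegral_of_indepFun (hN.measurable_count hB)
    (hN.measurable_count hC) h2
  simp only [Pi.mul_apply] at this
  rw [this, hN.lintegral_count hB hb, hN.lintegral_count hC hc]

/-- The second moment measure of a Poisson process on rectangles. -/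
lemma lintegral_count_mul [IsProbabilityMeasure P] (hN : IsPoissonProcess P N ν)
    {B C : Set Plane} (hB : MeasurableSet B) (hb : Bornology.IsBounded B)
    (hC : MeasurableSet C) (hc : Bornology.IsBounded C) :
    ∫⁻ ω, N ω B * N ω C ∂P = (ν * volume B) * (ν * volume C) + ν * volume (B ∩ C) := by
  have hI := hB.inter hC
  have hi : Bornology.IsBounded (B ∩ C) := hb.subset Set.inter_subset_left
  have hd1 : Bornology.IsBounded (B \ C) := hb.subset Set.sdiff_subset
  have hd2 : Bornology.IsBounded (C \ B) := hc.subset Set.sdiff_subset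
  have e1 : ∀ M : Measure Plane, M B = M (B ∩ C) + M (B \ C) := fun M =>
    (measure_inter_add_sdiff B hC).symm
  have e2 : ∀ M : Measure Plane, M C = M (B ∩ C) + M (C \ B) := fun M => by
    rw [Set.inter_comm]; exact (measure_inter_add_sdiff C hB).symm
  have m1 := hN.measurable_count hI
  have m2 := hN.measurable_count (hB.diff hC)
  have m3 := hN.measurable_count (hC.diff hB)
  -- Only the square of the common part fails to factor by independence; its excess is the diagonal
  -- term `ν |B ∩ C|`.
  have hexp : ∀ ω, N ω B * N ω C = N ω (B ∩ C) * N ω (B ∩ C) + N ω (B ∩ C) * N ω (C \ B) +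
      N ω (B \ C) * N ω (B ∩ C) + N ω (B \ C) * N ω (C \ B) := fun ω => by
    rw [e1 (N ω), e2 (N ω)]; ring
  simp_rw [hexp]
  rw [lintegral_add_right _ (by fun_prop), lintegral_add_right _ (by fun_prop),
    lintegral_add_right _ (by fun_prop), hN.lintegral_count_sq hI hi,
    hN.lintegral_count_mul_of_disjoint hI hi (hC.diff hB) hd2
      (Set.disjoint_left.2 fun x hx hx' => hx'.2 hx.1),
    hN.lintegral_count_mul_of_disjoint (hB.diff hC) hd1 hI hi
      (Set.disjoint_left.2 fun x hx hx' => hx.2 hx'.2),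
    hN.lintegral_count_mul_of_disjoint (hB.diff hC) hd1 (hC.diff hB) hd2
      (Set.disjoint_left.2 fun x hx hx' => hx.2 hx'.1), e1 volume, e2 volume]
  ring

end IsPoissonProcess

/-- A measurable family of finite measures with integer total mass is an s-finite kernel. -/
lemma isSFiniteKernel_of_natCast_mass {β : Type*} [MeasurableSpace β] (κ : Kernel Ω β)
    (h : ∀ ω, ∃ j : ℕ, κ ω Set.univ = j) : IsSFiniteKernel κ := by
  have hm : ∀ j : ℕ, MeasurableSet {ω | κ ω Set.univ = j} := fun j =>
    κ.measurable_coe MeasurableSet.univ (measurableSet_singleton _)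
  classical
  -- Cutting `Ω` by the value of the total mass: the `j`-th piece has mass at most `j`, and at each
  -- `ω` only the piece of the actual mass can contribute.
  let κ' : ℕ → Kernel Ω β := fun j => Kernel.piecewise (hm j) κ 0
  have hfin : ∀ j, IsFiniteKernel (κ' j) := fun j => by
    refine ⟨⟨j, ENNReal.natCast_lt_top j, fun ω => ?_⟩⟩
    simp only [κ', Kernel.piecewise_apply]
    split_ifs with hω
    · exact le_of_eq hω
    · simp
  have hsum : κ = Kernel.sum κ' := by
    ext ω s hs
    obtain ⟨j, hj⟩ := h ω
    rw [Kernel.sum_apply' _ _ hs, tsum_eq_single j]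
    · simp [κ', Kernel.piecewise_apply, hj]
    · intro i hi
      have : ¬ κ ω Set.univ = i := by rw [hj]; exact_mod_cast hi.symm
      simp [κ', Kernel.piecewise_apply, this]
  rw [hsum]
  infer_instance

end

/-! ### Campbell formulas of first and second order. -/

section

/-- Integration against a random measure `κ` with mean measure `M` that is independent of `g`. -/
lemma lintegral_lintegral_of_indep_kernel {Ω Ω' β : Type*} {mΩ : MeasurableSpace Ω}
    {mΩ' : MeasurableSpace Ω'} [MeasurableSpace β] {P : Measure Ω} [IsProbabilityMeasure P]
    {g : Ω → Ω'} (hg : Measurable g) (κ : Kernel Ω β) [IsSFiniteKernel κ] (M : Measure β)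
    [IsFiniteMeasure M]
    (h : ∀ U, MeasurableSet U → ∀ B, MeasurableSet B →
      ∫⁻ ω in g ⁻¹' U, κ ω B ∂P = P (g ⁻¹' U) * M B)
    {F : Ω' × β → ℝ≥0∞} (hF : Measurable F) :
    ∫⁻ ω, ∫⁻ b, F (g ω, b) ∂(κ ω) ∂P = ∫⁻ b, ∫⁻ ω, F (g ω, b) ∂P ∂M := by
  -- The hypothesis `h` is this equality on rectangles, which determine a finite measure.
  have hQ : (P.map g).prod M = (P ⊗ₘ κ).map (Prod.map g id) := by
    have := Measure.isProbabilityMeasure_map (μ := P) hg.aemeasurable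
    refine Measure.ext_prod fun {U B} hU hB => ?_
    rw [Measure.prod_prod, Measure.map_apply (hg.prodMap measurable_id) (hU.prod hB),
      show Prod.map g id ⁻¹' U ×ˢ B = (g ⁻¹' U) ×ˢ B from rfl,
      Measure.compProd_apply_prod (hg hU) hB, h U hU B hB, Measure.map_apply hg hU]
  have h1 : ∫⁻ x, F (g x.1, x.2) ∂(P ⊗ₘ κ) = ∫⁻ ω, ∫⁻ b, F (g ω, b) ∂(κ ω) ∂P :=
    Measure.lintegral_compProd (μ := P) (κ := κ) (hF.comp (hg.prodMap measurable_id))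
  rw [← h1]
  have h2 := lintegral_map (μ := P ⊗ₘ κ) hF (hg.prodMap measurable_id)
  simp only [Prod.map_apply', id_eq] at h2
  have h3 : ∫⁻ a, F (g a.1, a.2) ∂(P ⊗ₘ κ) = ∫⁻ x, F x ∂((P.map g).prod M) := by
    rw [hQ, h2]
  rw [h3, lintegral_prod_symm' _ hF]
  refine lintegral_congr fun b => ?_
  exact lintegral_map (f := fun x => F (x, b)) (hF.comp measurable_prodMk_right) hg

variable {Ω : Type*} {m₁ : MeasurableSpace Ω} {mΩ : MeasurableSpace Ω} {P : Measure Ω} {N : Ω → Measure Plane} {ν : ℝ≥0}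

lemma measurable_measure_restrict {β : Type*} [MeasurableSpace β] {S : Set β}
    (hS : MeasurableSet S) : Measurable fun M : Measure β => M.restrict S :=
  Measure.measurable_of_measurable_coe _ fun B hB => by
    simpa [Measure.restrict_apply hB] using Measure.measurable_coe (hB.inter hS)

namespace IsPoissonProcess

/-- The points of the process in a window, as a kernel. -/
noncomputable def windowKernel (hN : IsPoissonProcess P N ν) {S : Set Plane}
    (hS : MeasurableSet S) : Kernel Ω Plane :=
  ⟨fun ω => (N ω).restrict S, (measurable_measure_restrict hS).comp hN.measurable⟩

lemma windowKernel_apply (hN : IsPoissonProcess P N ν) {S : Set Plane}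
    (hS : MeasurableSet S) (ω : Ω) : hN.windowKernel hS ω = (N ω).restrict S := rfl

lemma isSFiniteKernel_windowKernel (hN : IsPoissonProcess P N ν) {S : Set Plane}
    (hS : MeasurableSet S) (hb : Bornology.IsBounded S) :
    IsSFiniteKernel (hN.windowKernel hS) :=
  isSFiniteKernel_of_natCast_mass _ fun ω => by
    simpa [windowKernel_apply] using hN.count ω S hS hb

lemma isFiniteMeasure_restrict (hN : IsPoissonProcess P N ν) {S : Set Plane}
    (hS : MeasurableSet S) (hb : Bornology.IsBounded S) (ω : Ω) :
    IsFiniteMeasure ((N ω).restrict S) := by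
  obtain ⟨j, hj⟩ := hN.count ω S hS hb
  exact ⟨by simp [hj]⟩

lemma measurable_comap_count {B : Set Plane} (hB : MeasurableSet B) :
    Measurable[MeasurableSpace.comap N inferInstance] fun ω => N ω B :=
  (Measure.measurable_coe hB).comp (comap_measurable N)

/-- A variable measurable with respect to a σ-algebra independent of another one factors out of
the integral over an event of the latter. -/
lemma setLIntegral_of_indep {Ω : Type*} {m₁ m₂ mΩ : MeasurableSpace Ω} {P : Measure Ω} (h₁ : m₁ ≤ mΩ) (h₂ : m₂ ≤ mΩ)
    (hind : Indep m₁ m₂ P) {U : Set Ω} (hU : MeasurableSet[m₁] U) {f : Ω → ℝ≥0∞}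
    (hf : Measurable[m₂] f) : ∫⁻ ω in U, f ω ∂P = P U * ∫⁻ ω, f ω ∂P := by
  have hU' := h₁ _ hU
  have := lintegral_mul_eq_lintegral_mul_lintegral_of_independent_measurableSpace h₁ h₂ hind
    (f := U.indicator fun _ => 1) (g := f) (measurable_const.indicator hU) hf
  rw [lintegral_indicator_const hU', one_mul] at this
  rw [← this, ← lintegral_indicator hU']
  refine lintegral_congr fun ω => ?_
  by_cases h : ω ∈ U <;> simp [h]

variable [IsProbabilityMeasure P]

/-- Campbell's formula. -/
lemma lintegral_window (hN : IsPoissonProcess P N ν) (h₁ : m₁ ≤ mΩ)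
    (hind : Indep m₁ (MeasurableSpace.comap N inferInstance) P)
    {S : Set Plane} (hS : MeasurableSet S) (hb : Bornology.IsBounded S)
    {F : Plane × Ω → ℝ≥0∞} (hF : Measurable[@Prod.instMeasurableSpace _ _ _ m₁] F) :
    ∫⁻ ω, ∫⁻ s in S, F (s, ω) ∂(N ω) ∂P = ν * ∫⁻ s in S, ∫⁻ ω, F (s, ω) ∂P := by
  have := hN.isSFiniteKernel_windowKernel hS hb
  have hfin : IsFiniteMeasure (volume.restrict S) := ⟨by simpa using hb.measure_lt_top⟩
  have hM : IsFiniteMeasure (ν • volume.restrict S) := inferInstance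
  -- The identity is read as a map from `Ω` to `Ω` with the smaller σ-algebra `m₁`, so that only
  -- events independent of the process are tested.
  have key := lintegral_lintegral_of_indep_kernel (mΩ' := m₁) (g := id) (P := P)
    (measurable_id'' h₁) (hN.windowKernel hS) (ν • volume.restrict S)
    (fun U hU B hB => by
      have hBS := hB.inter hS
      simp only [windowKernel_apply, Measure.restrict_apply hB, Set.preimage_id]
      rw [setLIntegral_of_indep h₁ hN.measurable.comap_le hind hU (measurable_comap_count hBS),
        hN.lintegral_count hBS (hb.subset Set.inter_subset_right)]
      rw [Measure.smul_apply, Measure.restrict_apply hB, ENNReal.smul_def, smul_eq_mul])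
    (F := fun p => F (p.2, p.1)) (hF.comp (@measurable_swap _ _ m₁ _))
  dsimp only [id_eq] at key
  simp_rw [windowKernel_apply] at key
  rw [key, lintegral_smul_measure]
  rfl

/-- The second order Campbell formula. -/
lemma lintegral_window_sq (hN : IsPoissonProcess P N ν) (h₁ : m₁ ≤ mΩ)
    (hind : Indep m₁ (MeasurableSpace.comap N inferInstance) P)
    {S : Set Plane} (hS : MeasurableSet S) (hb : Bornology.IsBounded S)
    {F : Plane × Ω → ℝ≥0∞} (hF : Measurable[@Prod.instMeasurableSpace _ _ _ m₁] F) :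
    ∫⁻ ω, (∫⁻ s in S, F (s, ω) ∂(N ω)) ^ 2 ∂P =
      ν ^ 2 * (∫⁻ s in S, ∫⁻ t in S, ∫⁻ ω, F (s, ω) * F (t, ω) ∂P) +
        ν * ∫⁻ s in S, ∫⁻ ω, F (s, ω) ^ 2 ∂P := by
  have := hN.isSFiniteKernel_windowKernel hS hb
  have hfin : IsFiniteMeasure (volume.restrict S) := ⟨by simpa using hb.measure_lt_top⟩
  have hdiag : Measurable fun s : Plane => (s, s) := measurable_id.prodMk measurable_id
  -- The second moment measure; the diagonal part arises from pairing each point with itself.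
  let M : Measure (Plane × Plane) := (ν ^ 2) • ((volume.restrict S).prod (volume.restrict S)) +
    ν • (volume.restrict S).map fun s => (s, s)
  have hM : IsFiniteMeasure M := inferInstance
  have hFswap : Measurable[@Prod.instMeasurableSpace _ _ m₁ _] fun p : Ω × Plane × Plane =>
      F (p.2.1, p.1) * F (p.2.2, p.1) := by
    refine Measurable.mul ?_ ?_
    · exact hF.comp ((measurable_fst.comp (@measurable_snd _ _ m₁ _)).prodMk
        (@measurable_fst _ _ m₁ _))
    · exact hF.comp ((measurable_snd.comp (@measurable_snd _ _ m₁ _)).prodMk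
        (@measurable_fst _ _ m₁ _))
  have hrect : ∀ U, MeasurableSet[m₁] U → ∀ D, MeasurableSet D →
      ∫⁻ ω in U, (hN.windowKernel hS ×ₖ hN.windowKernel hS) ω D ∂P = P U * M D := by
    intro U hU D hD
    -- As an equality of measures in `D`, the claim need only be checked on rectangles, where the
    -- product moment of counts is known.
    suffices h : P U • M = (P.restrict U).bind (hN.windowKernel hS ×ₖ hN.windowKernel hS) by
      have := congrArg (fun L : Measure (Plane × Plane) => L D) h
      simp only [Measure.smul_apply, smul_eq_mul] at this
      rw [this, Measure.bind_apply hD (Kernel.aemeasurable _)]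
    have hfin' : IsFiniteMeasure (P U • M) := Measure.smul_finite _ (measure_ne_top _ _)
    refine Measure.ext_prod fun {B C} hB hC => ?_
    have hBS := hB.inter hS
    have hCS := hC.inter hS
    rw [Measure.bind_apply (hB.prod hC) (Kernel.aemeasurable _)]
    simp only [Kernel.prod_apply_prod, windowKernel_apply, Measure.restrict_apply hB,
      Measure.restrict_apply hC]
    rw [setLIntegral_of_indep h₁ hN.measurable.comap_le hind hU
        (f := fun ω => N ω (B ∩ S) * N ω (C ∩ S))
        (Measurable.mul (measurable_comap_count hBS) (measurable_comap_count hCS)),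
      hN.lintegral_count_mul hBS (hb.subset Set.inter_subset_right) hCS
        (hb.subset Set.inter_subset_right)]
    simp only [M, Measure.smul_apply, Measure.add_apply, Measure.prod_prod, smul_eq_mul,
      Measure.map_apply hdiag (hB.prod hC), Measure.restrict_apply hB, Measure.restrict_apply hC,
      Measure.restrict_apply (hdiag (hB.prod hC)), ENNReal.smul_def, ENNReal.coe_pow]
    have : (fun s : Plane => (s, s)) ⁻¹' B ×ˢ C ∩ S = B ∩ S ∩ (C ∩ S) := by
      ext x; simp only [Set.mem_inter_iff, Set.mem_preimage, Set.mem_prod]; tauto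
    rw [this]
    ring
  have key := lintegral_lintegral_of_indep_kernel (mΩ' := m₁) (g := id) (P := P)
    (measurable_id'' h₁) (hN.windowKernel hS ×ₖ hN.windowKernel hS) M hrect hFswap
  have hFmeas : Measurable F := hF.mono
    (sup_le_sup le_rfl (MeasurableSpace.comap_mono h₁)) le_rfl
  have hFω : ∀ ω, Measurable fun s => F (s, ω) := fun ω => hFmeas.comp measurable_prodMk_right
  have hFF : Measurable fun p : Plane × Plane => ∫⁻ ω, F (p.1, ω) * F (p.2, ω) ∂P := by
    refine Measurable.lintegral_prod_right' (f := fun q : (Plane × Plane) × Ω =>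
      F (q.1.1, q.2) * F (q.1.2, q.2)) ?_
    fun_prop
  simp only [id_eq, Kernel.prod_apply, windowKernel_apply] at key
  have hL : ∀ ω, (∫⁻ s in S, F (s, ω) ∂(N ω)) ^ 2 =
      ∫⁻ b, F (b.1, ω) * F (b.2, ω) ∂((N ω).restrict S).prod ((N ω).restrict S) := fun ω => by
    have := hN.isFiniteMeasure_restrict hS hb ω
    rw [lintegral_prod_mul (hFω ω).aemeasurable (hFω ω).aemeasurable, sq]
  simp_rw [hL]
  rw [key, lintegral_add_measure, lintegral_smul_measure, lintegral_smul_measure,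
    lintegral_map hFF hdiag, lintegral_prod _ hFF.aemeasurable]
  simp only [ENNReal.smul_def, smul_eq_mul, sq, ENNReal.coe_mul]

end IsPoissonProcess

end

end SpatialExtremogram

open scoped BoundedContinuousFunction

namespace SpatialExtremogram

/-! ### From vague convergence to convergence on continuity sets. -/

section

/-- Weakly convergent finite measures converge on continuity sets. -/
lemma tendsto_measureReal_of_null_frontier {V : Type*} [TopologicalSpace V]
    [HasOuterApproxClosed V] [MeasurableSpace V] [OpensMeasurableSpace V]
    {κ : ℕ → FiniteMeasure V} {κ₀ : FiniteMeasure V} (h : Tendsto κ atTop (𝓝 κ₀)) {B : Set V}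
    (hB : MeasurableSet B) (hfr : (κ₀ : Measure V) (frontier B) = 0) :
    Tendsto (fun n => (κ n : Measure V).real B) atTop (𝓝 ((κ₀ : Measure V).real B)) := by
  have hmass : Tendsto (fun n => (κ n : Measure V).real Set.univ) atTop
      (𝓝 ((κ₀ : Measure V).real Set.univ)) := by
    have := (FiniteMeasure.continuous_mass.tendsto κ₀).comp h
    exact (NNReal.continuous_coe.tendsto _).comp this
  -- Only upper bounds come from the portmanteau inequality for closed sets; the lower bound for `B`
  -- is the upper bound for `Bᶜ` combined with convergence of the total masses.
  have key : ∀ D : Set V, MeasurableSet D → (κ₀ : Measure V) (frontier D) = 0 →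
      ∀ δ : ℝ, 0 < δ → ∀ᶠ n in atTop, (κ n : Measure V).real D < (κ₀ : Measure V).real D + δ := by
    intro D hD hfr δ hδ
    have h1 := FiniteMeasure.limsup_measure_closed_le_of_tendsto h
      (isClosed_closure (s := D))
    have h2 : (κ₀ : Measure V) (closure D) = (κ₀ : Measure V) D :=
      measure_closure_of_null_frontier hfr
    have h3 : limsup (fun n => (κ n : Measure V) (closure D)) atTop <
        ENNReal.ofReal ((κ₀ : Measure V).real D + δ) := by
      refine h1.trans_lt ?_
      rw [h2, ← ofReal_measureReal]
      exact (ENNReal.ofReal_lt_ofReal_iff (by positivity)).2 (by linarith)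
    filter_upwards [eventually_lt_of_limsup_lt h3] with n hn
    have h4 := (measure_mono subset_closure).trans_lt hn
    rw [← ofReal_measureReal] at h4
    exact (ENNReal.ofReal_lt_ofReal_iff (by positivity)).1 h4
  refine tendsto_order.2 ⟨fun b hb => ?_, fun b hb => ?_⟩
  · set δ := (κ₀ : Measure V).real B - b
    have hδ : 0 < δ := sub_pos.2 hb
    filter_upwards [key Bᶜ hB.compl (by rwa [frontier_compl]) (δ / 2) (by positivity),
      hmass.eventually_const_lt
        (show (κ₀ : Measure V).real Set.univ - δ / 2 < (κ₀ : Measure V).real Set.univ by linarith)]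
      with n h1 h2
    rw [measureReal_compl hB, measureReal_compl hB] at h1
    simp only [δ] at *
    linarith
  · filter_upwards [key B hB hfr _ (sub_pos.2 hb)] with n hn
    linarith

/-- Vague convergence away from a point `z` gives convergence on continuity sets that are bounded
away from `z`. -/
lemma tendsto_measureReal_of_vague {V : Type*} [PseudoMetricSpace V] [MeasurableSpace V]
    [BorelSpace V] {κ : ℕ → Measure V} [∀ n, IsFiniteMeasure (κ n)] {κ₀ : Measure V} {z : V}
    (hfin : ∀ r : ℝ, 0 < r → κ₀ {x | r ≤ dist x z} < ∞)
    (h : ∀ f : V →ᵇ ℝ, (∀ᶠ x in 𝓝 z, f x = 0) →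
      Tendsto (fun n => ∫ x, f x ∂(κ n)) atTop (𝓝 (∫ x, f x ∂κ₀)))
    {B : Set V} (hB : MeasurableSet B) (hz : z ∉ closure B) (hfr : κ₀ (frontier B) = 0) :
    Tendsto (fun n => (κ n).real B) atTop (𝓝 (κ₀.real B)) := by
  obtain ⟨ρ, hρ, hρB⟩ := Metric.nhds_basis_ball.mem_iff.1
    (isClosed_closure.isOpen_compl.mem_nhds hz : (closure B)ᶜ ∈ 𝓝 z)
  -- A continuous cutoff, 0 within `ρ / 2` of `z` and 1 on `B`. With density `g` the measures become
  -- finite, keep their values on `B`, and converge weakly.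
  let g : V → ℝ≥0 := fun x => min 1 (Real.toNNReal (2 * dist x z / ρ - 1))
  have hg : Continuous g := by fun_prop
  have hg0 : ∀ x, dist x z ≤ ρ / 2 → g x = 0 := fun x hx => by
    have : 2 * dist x z / ρ - 1 ≤ 0 := by
      rw [sub_nonpos, div_le_one hρ]; linarith
    simp [g, Real.toNNReal_of_nonpos this]
  have hg1 : ∀ x ∈ B, g x = 1 := fun x hx => by
    have : ρ ≤ dist x z := by
      by_contra hlt
      exact hρB (Metric.mem_ball.2 (not_le.1 hlt)) (subset_closure hx)
    refine min_eq_left ?_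
    rw [← Real.toNNReal_one]
    refine Real.toNNReal_le_toNNReal ?_
    have : 1 ≤ dist x z / ρ := (one_le_div hρ).2 this
    rw [mul_div_assoc]; linarith
  have hgle : ∀ x, g x ≤ 1 := fun x => min_le_left _ _
  have hgm : Measurable fun x => (g x : ℝ≥0∞) := hg.measurable.coe_nnreal_ennreal
  have hwB : ∀ η : Measure V, (η.withDensity fun x => (g x : ℝ≥0∞)) B = η B := fun η => by
    rw [withDensity_apply _ hB, setLIntegral_congr_fun (g := fun _ => 1) hB
      (fun x hx => by simp [hg1 x hx])]
    simp
  have hwfin : ∀ η : Measure V, η {x | ρ / 2 ≤ dist x z} < ∞ →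
      IsFiniteMeasure (η.withDensity fun x => (g x : ℝ≥0∞)) := fun η hη => by
    have hms : MeasurableSet {x : V | ρ / 2 ≤ dist x z} :=
      measurableSet_le measurable_const (by fun_prop)
    refine ⟨?_⟩
    rw [withDensity_apply _ MeasurableSet.univ, Measure.restrict_univ]
    refine lt_of_le_of_lt (b := ∫⁻ x, Set.indicator {x | ρ / 2 ≤ dist x z} (fun _ => 1) x ∂η)
      (lintegral_mono fun x => ?_) (by simpa [lintegral_indicator_const hms] using hη)
    by_cases hx : ρ / 2 ≤ dist x z
    · simpa [Set.indicator_of_mem (show x ∈ {x | ρ / 2 ≤ dist x z} from hx)] using hgle x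
    · simp [hg0 x (not_le.1 hx).le]
  have hf1 := fun n => hwfin (κ n) (measure_lt_top _ _)
  have hf0 := hwfin κ₀ (hfin _ (by positivity))
  let κ' : ℕ → FiniteMeasure V := fun n => ⟨_, hf1 n⟩
  let κ₀' : FiniteMeasure V := ⟨_, hf0⟩
  have hconv : Tendsto κ' atTop (𝓝 κ₀') := by
    rw [FiniteMeasure.tendsto_iff_forall_integral_tendsto]
    intro f
    let fg : V →ᵇ ℝ := BoundedContinuousFunction.ofNormedAddCommGroup (fun x => g x * f x)
      (by fun_prop) ‖f‖ (fun x => by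
        rw [norm_mul]
        have : ‖(g x : ℝ)‖ ≤ 1 := by simpa using hgle x
        calc _ ≤ 1 * ‖f‖ := mul_le_mul this (f.norm_coe_le_norm x) (norm_nonneg _) zero_le_one
          _ = _ := one_mul _)
    have h1 : ∀ η : Measure V, ∫ x, f x ∂(η.withDensity fun x => (g x : ℝ≥0∞)) =
        ∫ x, fg x ∂η := fun η => by
      rw [integral_withDensity_eq_integral_smul hg.measurable]
      rfl
    have h2 := h fg (by
      filter_upwards [Metric.closedBall_mem_nhds z (half_pos hρ)] with x hx
      simp [fg, hg0 x hx])
    simp only [← h1] at h2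
    exact h2
  have := tendsto_measureReal_of_null_frontier hconv hB
    (withDensity_absolutelyContinuous _ _ hfr)
  simpa only [κ', κ₀', FiniteMeasure.toMeasure_mk, measureReal_def, hwB]
    using this

end

/-! ### Stationarity, marginals of the limit measures, and pointwise limits. -/

section

/-- Measures that agree on continuous functions vanishing near `z` have the same closed null sets
away from `z`. -/
lemma measure_eq_zero_of_forall_integral_eq {V : Type*} [PseudoMetricSpace V] [MeasurableSpace V]
    [BorelSpace V] {η η' : Measure V} {z : V}
    (hfin : ∀ r : ℝ, 0 < r → η {x | r ≤ dist x z} < ∞)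
    (hfin' : ∀ r : ℝ, 0 < r → η' {x | r ≤ dist x z} < ∞)
    (h : ∀ f : V →ᵇ ℝ, (∀ᶠ x in 𝓝 z, f x = 0) → ∫ x, f x ∂η = ∫ x, f x ∂η')
    {F : Set V} (hF : IsClosed F) (hz : z ∉ F) (h0 : η' F = 0) : η F = 0 := by
  obtain ⟨ρ, hρ, hρF⟩ := Metric.nhds_basis_ball.mem_iff.1
    (hF.isOpen_compl.mem_nhds hz : Fᶜ ∈ 𝓝 z)
  -- `F` misses the ball of radius `ρ` about `z`, and `ρ / 4 + 3ρ / 4 = ρ`.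
  have hfar : ∀ δ ≤ ρ / 2, Metric.cthickening δ F ⊆ {x | ρ / 4 ≤ dist x z} := by
    intro δ hδ x hx
    by_contra hlt
    simp only [Set.mem_ofPred_eq, not_le] at hlt
    have hx' : x ∈ Metric.thickening (3 * ρ / 4) F :=
      Metric.cthickening_subset_thickening' (by positivity) (by linarith) F hx
    obtain ⟨w, hw, hd⟩ := Metric.mem_thickening_iff.1 hx'
    refine hρF (Metric.mem_ball.2 ?_) hw
    have := dist_triangle w x z
    rw [dist_comm w x] at this
    linarith
  have hlim : Tendsto (fun δ => η' (Metric.cthickening δ F)) (𝓝[>] 0) (𝓝 0) := by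
    have := tendsto_measure_cthickening_of_isClosed (μ := η') (s := F)
      ⟨ρ / 2, by positivity, ((measure_mono (hfar _ le_rfl)).trans_lt
        (hfin' _ (by positivity))).ne⟩ hF
    rw [h0] at this
    exact this.mono_left nhdsWithin_le_nhds
  refine le_antisymm (ge_of_tendsto hlim ?_) zero_le
  filter_upwards [Ioc_mem_nhdsGT (show (0 : ℝ) < ρ / 2 by positivity)] with δ hδ
  let f₀ := thickenedIndicator hδ.1 F
  have hle : ∀ x, f₀ x ≤ 1 := thickenedIndicator_le_one hδ.1 F
  let f : V →ᵇ ℝ := BoundedContinuousFunction.ofNormedAddCommGroup (fun x => (f₀ x : ℝ))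
    (by fun_prop) 1 (fun x => by
      rw [Real.norm_of_nonneg (NNReal.coe_nonneg _)]
      exact_mod_cast hle x)
  have hsupp : ∀ x ∉ Metric.cthickening δ F, f x = 0 := fun x hx => by
    have : f₀ x = 0 := thickenedIndicator_zero hδ.1 F
      (fun hx' => hx (Metric.thickening_subset_cthickening _ _ hx'))
    simp [f, this]
  have hms : MeasurableSet (Metric.cthickening δ F) := Metric.isClosed_cthickening.measurableSet
  have hint : ∀ κ : Measure V, (∀ r : ℝ, 0 < r → κ {x | r ≤ dist x z} < ∞) →
      ENNReal.ofReal (∫ x, f x ∂κ) = ∫⁻ x, f₀ x ∂κ := by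
    intro κ hκ
    have hlt : κ (Metric.cthickening δ F) < ∞ :=
      (measure_mono (hfar _ hδ.2)).trans_lt (hκ _ (by positivity))
    have hi : Integrable f κ := by
      refine IntegrableOn.integrable_of_forall_notMem_eq_zero (s := Metric.cthickening δ F) ?_
        hsupp
      exact Measure.integrableOn_of_bounded hlt.ne f.continuous.aestronglyMeasurable (M := ‖f‖)
        (ae_of_all _ fun x => f.norm_coe_le_norm x)
    rw [ofReal_integral_eq_lintegral_ofReal hi (ae_of_all _ fun x => NNReal.coe_nonneg _)]
    exact lintegral_congr fun x => ENNReal.ofReal_coe_nnreal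
  have hvan : ∀ᶠ x in 𝓝 z, f x = 0 := by
    filter_upwards [Metric.ball_mem_nhds z (show 0 < ρ / 4 by positivity)] with x hx
    refine hsupp x fun hx' => ?_
    have := hfar _ hδ.2 hx'
    rw [Metric.mem_ball] at hx
    exact absurd this (not_le.2 hx)
  calc η F = ∫⁻ x, F.indicator (fun _ => 1) x ∂η := by
        rw [lintegral_indicator_const hF.measurableSet, one_mul]
    _ ≤ ∫⁻ x, f₀ x ∂η := by
        refine lintegral_mono fun x => ?_
        by_cases hx : x ∈ F
        · simp [hx, f₀, thickenedIndicator_one hδ.1 F hx]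
        · simp [hx]
    _ = ∫⁻ x, f₀ x ∂η' := by rw [← hint η hfin, h f hvan, hint η' hfin']
    _ ≤ ∫⁻ x, (Metric.cthickening δ F).indicator (fun _ => 1) x ∂η' := by
        refine lintegral_mono fun x => ?_
        by_cases hx : x ∈ Metric.cthickening δ F
        · rw [Set.indicator_of_mem hx]
          exact ENNReal.coe_le_one_iff.2 (hle x)
        · have := hsupp x hx
          have h2 : f₀ x = 0 := NNReal.coe_eq_zero.1 this
          simp [h2]
    _ = η' (Metric.cthickening δ F) := by rw [lintegral_indicator_const hms, one_mul]

variable {Ω E : Type*} [MeasurableSpace Ω] {P : Measure Ω}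
  [MeasurableSpace E] {X : Plane → Ω → E}

namespace IsStationary

lemma map_pair (hX : IsStationary P X) (hm : ∀ s, Measurable (X s)) (s t : Plane) :
    P.map (fun ω => (X s ω, X t ω)) = P.map fun ω => (X 0 ω, X (t - s) ω) := by
  classical
  have h := hX {0, t - s} s
  -- Evaluating at named members also covers `s = t`, where the pair collapses to one site.
  let φ : (({0, t - s} : Finset Plane) → E) → E × E := fun x =>
    (x ⟨0, by simp⟩, x ⟨t - s, by simp⟩)
  have hφ : Measurable φ := by fun_prop
  have h' := congrArg (Measure.map φ) h
  rw [Measure.map_map hφ (by fun_prop), Measure.map_map hφ (by fun_prop)] at h'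
  simpa [φ, Function.comp_def] using h'

lemma map_eq (hX : IsStationary P X) (hm : ∀ s, Measurable (X s)) (t : Plane) :
    P.map (X t) = P.map (X 0) := by
  have h := congrArg (Measure.map Prod.fst) (hX.map_pair hm t t)
  rwa [Measure.map_map (by fun_prop) (by fun_prop), Measure.map_map (by fun_prop) (by fun_prop)]
    at h

end IsStationary

section RegularVariation

variable [NormedAddCommGroup E] [NormedSpace ℝ E] [BorelSpace E] [SecondCountableTopology E]
  {α : ℝ} {a : ℕ → ℝ} {μ : (H : Finset Plane) → Measure (H → E)}

/-- Vague convergence of the rescaled law of the field at finitely many sites, on sets. -/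
lemma IsRegularlyVarying.tendsto_finset [IsProbabilityMeasure P] (hX : IsRegularlyVarying P X α a μ)
    (hm : ∀ s, Measurable (X s)) {H : Finset Plane} (hH : H.Nonempty) {B : Set (H → E)}
    (hB : MeasurableSet B) (h0 : (0 : H → E) ∉ closure B) (hfr : μ H (frontier B) = 0) :
    Tendsto (fun n : ℕ => (n : ℝ) * P.real {ω | (fun s : H => (a n)⁻¹ • X s ω) ∈ B}) atTop
      (𝓝 ((μ H).real B)) := by
  have hmeas : ∀ n, Measurable fun ω => fun s : H => (a n)⁻¹ • X s ω := fun n => by fun_prop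
  let κ : ℕ → Measure (H → E) := fun n => (n : ℝ≥0) • P.map fun ω => fun s : H => (a n)⁻¹ • X s ω
  have hκ : ∀ n, IsFiniteMeasure (κ n) := fun n => inferInstance
  have := tendsto_measureReal_of_vague (κ := κ) (κ₀ := μ H) (z := 0)
    (fun r hr => by simpa [dist_zero_right] using hX.finite H hH r hr)
    (fun f hf => by
      refine (hX.vague H hH f hf).congr fun n => ?_
      simp only [κ]
      rw [integral_smul_nnreal_measure, integral_map (hmeas n).aemeasurable
        f.continuous.aestronglyMeasurable]
      simp [NNReal.smul_def]) hB h0 hfr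
  refine this.congr fun n => ?_
  simp only [κ]
  rw [measureReal_nnreal_smul_apply, map_measureReal_apply (hmeas n) hB]
  rfl

-- By stationarity both integrals are limits of the same sequence `n E f(X_0 / a_n)`, whatever the
-- set `H` and the site `t`.
omit [SecondCountableTopology E] in
lemma IsRegularlyVarying.integral_eval [IsProbabilityMeasure P] (hX : IsRegularlyVarying P X α a μ)
    (hst : IsStationary P X) (hm : ∀ s, Measurable (X s)) {H : Finset Plane} (t : H)
    (f : E →ᵇ ℝ) (hf : ∀ᶠ x in 𝓝 (0 : E), f x = 0) :
    ∫ x, f (x t) ∂(μ H) = ∫ x, f x ∂(oneSite μ) := by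
  have key : ∀ (H : Finset Plane) (t : H), Tendsto (fun n : ℕ => (n : ℝ) *
      ∫ ω, f ((a n)⁻¹ • X 0 ω) ∂P) atTop (𝓝 (∫ x, f (x t) ∂(μ H))) := by
    intro H t
    let g : (H → E) →ᵇ ℝ := f.compContinuous ⟨fun x => x t, continuous_apply t⟩
    have hg : ∀ᶠ x in 𝓝 (0 : H → E), g x = 0 :=
      ((continuous_apply t).tendsto (0 : H → E)).eventually hf
    refine (hX.vague H ⟨t, t.2⟩ g hg).congr fun n => ?_
    have h1 : ∀ s, ∫ ω, f ((a n)⁻¹ • X s ω) ∂P = ∫ x, f ((a n)⁻¹ • x) ∂(P.map (X s)) :=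
      fun s => by
        rw [integral_map (hm s).aemeasurable]
        exact (by fun_prop : Continuous fun x => f ((a n)⁻¹ • x)).aestronglyMeasurable
    congr 1
    change ∫ ω, f ((a n)⁻¹ • X t ω) ∂P = _
    rw [h1, h1, hst.map_eq hm]
  have h0 := key {0} ⟨0, Finset.mem_singleton_self 0⟩
  have := tendsto_nhds_unique (key H t) h0
  rw [this, oneSite, integral_map (measurable_pi_apply _).aemeasurable f.continuous.aestronglyMeasurable]

lemma IsRegularlyVarying.map_eval_lt_top (hX : IsRegularlyVarying P X α a μ)
    {H : Finset Plane} (t : H) {r : ℝ} (hr : 0 < r) :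
    (μ H).map (fun x => x t) {x | r ≤ dist x 0} < ∞ := by
  have : MeasurableSet {x : E | r ≤ dist x 0} :=
    measurableSet_le measurable_const (by fun_prop)
  rw [Measure.map_apply (measurable_pi_apply t) this]
  refine (measure_mono fun x hx => ?_).trans_lt (hX.finite H ⟨t, t.2⟩ r hr)
  simp only [Set.mem_preimage, Set.mem_ofPred_eq, dist_zero_right] at hx ⊢
  exact hx.trans (norm_le_pi_norm x t)

/-- The one-site marginals of the limit measures do not charge the boundary of a continuity set
of the one-site limit measure. -/
lemma IsRegularlyVarying.measure_eval_frontier [IsProbabilityMeasure P] (hX : IsRegularlyVarying P X α a μ)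
    (hst : IsStationary P X) (hm : ∀ s, Measurable (X s)) {A : Set E} (hA0 : (0 : E) ∉ closure A)
    (hfr : oneSite μ (frontier A) = 0) {H : Finset Plane} (t : H) :
    μ H {x | x t ∈ frontier A} = 0 := by
  have := measure_eq_zero_of_forall_integral_eq (η := (μ H).map fun x => x t) (η' := oneSite μ)
    (z := 0) (fun r hr => hX.map_eval_lt_top t hr) (fun r hr => hX.map_eval_lt_top _ hr)
    (fun f hf => by
      rw [integral_map (measurable_pi_apply _).aemeasurable f.continuous.aestronglyMeasurable,
        hX.integral_eval hst hm t f hf])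
    isClosed_frontier (fun h => hA0 (frontier_subset_closure h)) hfr
  rwa [Measure.map_apply (measurable_pi_apply t) isClosed_frontier.measurableSet] at this

lemma IsRegularlyVarying.tendsto_pPre [IsProbabilityMeasure P] (hX : IsRegularlyVarying P X α a μ)
    (hm : ∀ s, Measurable (X s)) {A : Set E} (hA : MeasurableSet A) (hA0 : (0 : E) ∉ closure A)
    (hfr : oneSite μ (frontier A) = 0) :
    Tendsto (pPre P X a A) atTop (𝓝 ((oneSite μ).real A)) := by
  let e : (({0} : Finset Plane) → E) → E := fun x => x ⟨0, Finset.mem_singleton_self 0⟩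
  have he : Continuous e := continuous_apply _
  have h := hX.tendsto_finset hm (H := {0}) (by simp) (B := e ⁻¹' A) (he.measurable hA)
    (fun h => hA0 (he.closure_preimage_subset A h)) (by
      refine measure_mono_null (he.frontier_preimage_subset A) ?_
      rwa [oneSite, Measure.map_apply he.measurable isClosed_frontier.measurableSet] at hfr)
  rw [oneSite, map_measureReal_apply he.measurable hA]
  exact h

/-- The boundary of the joint event lies in the two cylinders over `frontier A`, both null by
`measure_eval_frontier`. Existence of a limit is what makes the `limUnder` in `tau` meaningful. -/
lemma IsRegularlyVarying.exists_tendsto_tauPre [IsProbabilityMeasure P] (hX : IsRegularlyVarying P X α a μ)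
    (hst : IsStationary P X) (hm : ∀ s, Measurable (X s)) {A : Set E} (hA : MeasurableSet A)
    (hA0 : (0 : E) ∉ closure A) (hfr : oneSite μ (frontier A) = 0) (y : Plane) :
    ∃ L, Tendsto (fun k => tauPre P X a A A k y) atTop (𝓝 L) := by
  classical
  let H : Finset Plane := {0, y}
  let s : H := ⟨0, by simp [H]⟩
  let t : H := ⟨y, by simp [H]⟩
  have hs : Continuous fun x : H → E => x s := continuous_apply _
  have ht : Continuous fun x : H → E => x t := continuous_apply _
  refine ⟨_, hX.tendsto_finset hm (H := H) ⟨0, by simp [H]⟩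
    (B := (fun x => x s) ⁻¹' A ∩ (fun x => x t) ⁻¹' A)
    ((hs.measurable hA).inter (ht.measurable hA)) (fun h => hA0 ?_) ?_⟩
  · exact hs.closure_preimage_subset A (closure_mono Set.inter_subset_left h)
  · refine measure_mono_null (t := {x | x s ∈ frontier A} ∪ {x | x t ∈ frontier A}) ?_
      (measure_union_null (hX.measure_eval_frontier hst hm hA0 hfr s)
        (hX.measure_eval_frontier hst hm hA0 hfr t))
    refine (frontier_inter_subset _ _).trans (Set.union_subset_union ?_ ?_)
    · exact Set.inter_subset_left.trans (hs.frontier_preimage_subset A)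
    · exact Set.inter_subset_right.trans (ht.frontier_preimage_subset A)

lemma IsRegularlyVarying.tendsto_tau [IsProbabilityMeasure P] (hX : IsRegularlyVarying P X α a μ)
    (hst : IsStationary P X) (hm : ∀ s, Measurable (X s)) {A : Set E} (hA : MeasurableSet A)
    (hA0 : (0 : E) ∉ closure A) (hfr : oneSite μ (frontier A) = 0) {m : ℕ → ℕ}
    (hlim : Tendsto m atTop atTop) (y : Plane) :
    Tendsto (fun n => tauPre P X a A A (m n) y) atTop (𝓝 (tau P X a m A A y)) := by
  obtain ⟨L, hL⟩ := hX.exists_tendsto_tauPre hst hm hA hA0 hfr y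
  exact tendsto_nhds_limUnder ⟨L, hL.comp hlim⟩

end RegularVariation

end

/-! ### Limit of the integrated covariance. -/

section

lemma tendsto_setLIntegral_compl_ball {f : Plane → ℝ≥0∞} (hf : Measurable f)
    (hfin : ∫⁻ y, f y < ∞) :
    Tendsto (fun k : ℕ => ∫⁻ y in (Metric.ball (0 : Plane) k)ᶜ, f y) atTop (𝓝 0) := by
  have h : Tendsto (fun k : ℕ => ∫⁻ y, (Metric.ball (0 : Plane) k)ᶜ.indicator f y) atTop
      (𝓝 (∫⁻ _ : Plane, 0)) := by
    refine tendsto_lintegral_of_dominated_convergence f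
      (fun k => hf.indicator Metric.isOpen_ball.measurableSet.compl)
      (fun k => ae_of_all _ fun y => Set.indicator_le_self _ _ _) hfin.ne
      (ae_of_all _ fun y => ?_)
    refine tendsto_const_nhds.congr' ?_
    obtain ⟨k₀, hk₀⟩ := exists_nat_gt ‖y‖
    filter_upwards [eventually_ge_atTop k₀] with k hk
    have : y ∈ Metric.ball (0 : Plane) k := by
      rw [mem_ball_zero_iff]
      exact hk₀.trans_le (by exact_mod_cast hk)
    simp [this]
  simpa [lintegral_indicator Metric.isOpen_ball.measurableSet.compl] using h

/-- An inequality suffices and also covers negative `r`, where the ball is empty. -/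
lemma volume_closedBall_zero_le (r : ℝ) :
    volume (Metric.closedBall (0 : Plane) r) ≤
      ENNReal.ofReal (r ^ 2) * volume (Metric.ball (0 : Plane) 1) := by
  rcases le_or_gt 0 r with hr | hr
  · rw [Measure.addHaar_closedBall _ _ hr]
    simp
  · simp [Metric.closedBall_eq_empty.2 hr]

/-- Convergence of the integrated normalized covariances `G n - (q n)²/M n`, weighted by `ρ n`:
they converge on bounded sets, and are negligible at intermediate and large distances. -/
lemma tendsto_integral_covariance {G ρ : ℕ → Plane → ℝ} {τ : Plane → ℝ} {q M r : ℕ → ℝ} {q₀ : ℝ}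
    (hGm : ∀ n, Measurable (G n)) (hG0 : ∀ n y, 0 ≤ G n y) (hGq : ∀ n y, G n y ≤ q n)
    (hρm : ∀ n, Measurable (ρ n)) (hρ0 : ∀ n y, 0 ≤ ρ n y) (hρ1 : ∀ n y, ρ n y ≤ 1)
    (hq : Tendsto q atTop (𝓝 q₀)) (hM : Tendsto M atTop atTop)
    (hr : (fun n => r n ^ 2) =o[atTop] M)
    (hG : ∀ y, Tendsto (fun n => G n y) atTop (𝓝 (τ y)))
    (hρ : ∀ y, Tendsto (fun n => ρ n y) atTop (𝓝 1))
    (hmid : Tendsto (fun k : ℕ => limsup (fun n : ℕ =>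
      ∫⁻ y in {y : Plane | (k : ℝ) ≤ ‖y‖ ∧ ‖y‖ ≤ r n}, ENNReal.ofReal (G n y)) atTop)
      atTop (𝓝 0))
    (hfar : Tendsto (fun n : ℕ => ∫⁻ y in {y : Plane | r n ≤ ‖y‖},
      ENNReal.ofReal |G n y - q n ^ 2 / M n|) atTop (𝓝 0))
    (hτ : ∫⁻ y, ENNReal.ofReal (τ y) < ∞) :
    Tendsto (fun n => ∫ y, (G n y - q n ^ 2 / M n) * ρ n y) atTop (𝓝 (∫ y, τ y)) := by
  have hτm : Measurable τ := measurable_of_tendsto_metrizable hGm (tendsto_pi_nhds.2 hG)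
  have hτ0 : ∀ y, 0 ≤ τ y := fun y => ge_of_tendsto' (hG y) fun n => hG0 n y
  have hτq : ∀ y, τ y ≤ q₀ := fun y => le_of_tendsto_of_tendsto' (hG y) hq fun n => hGq n y
  have hτi : Integrable τ := by
    refine ⟨hτm.aestronglyMeasurable, ?_⟩
    rw [hasFiniteIntegral_iff_ofReal (ae_of_all _ hτ0)]
    exact hτ
  have hqM : Tendsto (fun n => q n ^ 2 / M n) atTop (𝓝 0) := (hq.pow 2).div_atTop hM
  set C : ℕ → Plane → ℝ := fun n y => G n y - q n ^ 2 / M n with hC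
  have hCm : ∀ n, Measurable (C n) := fun n => (hGm n).sub_const _
  have hFm : ∀ n, Measurable fun y => C n y * ρ n y - τ y := fun n =>
    ((hCm n).mul (hρm n)).sub hτm
  have hCle : ∀ n, 0 ≤ M n → ∀ y, |C n y| ≤ G n y + q n ^ 2 / M n := fun n hn y => by
    refine (abs_sub _ _).trans (le_of_eq ?_)
    rw [abs_of_nonneg (hG0 n y), abs_of_nonneg (div_nonneg (sq_nonneg _) hn)]
  have hFle : ∀ n y, |C n y * ρ n y - τ y| ≤ |C n y| + τ y := fun n y => by
    refine (abs_sub _ _).trans ?_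
    rw [abs_mul, abs_of_nonneg (hρ0 n y), abs_of_nonneg (hτ0 y)]
    gcongr
    exact mul_le_of_le_one_right (abs_nonneg _) (hρ1 n y)
  have hnear : ∀ k : ℕ, Tendsto (fun n => ∫⁻ y in Metric.ball (0 : Plane) k,
      ENNReal.ofReal |C n y * ρ n y - τ y|) atTop (𝓝 0) := by
    intro k
    have h := tendsto_lintegral_filter_of_dominated_convergence
      (μ := volume.restrict (Metric.ball (0 : Plane) k)) (l := atTop)
      (F := fun n y => ENNReal.ofReal |C n y * ρ n y - τ y|) (f := fun _ => 0)
      -- Eventually `G ≤ q₀ + 1` and `q² / M ≤ 1`, while `τ ≤ q₀`.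
      (fun _ => ENNReal.ofReal (q₀ + 1 + 1 + q₀))
      (.of_forall fun n => (measurable_norm.comp (hFm n)).ennreal_ofReal)
      (by
        filter_upwards [hqM.eventually_lt_const one_pos, hM.eventually_ge_atTop 0,
          hq.eventually_lt_const (lt_add_one q₀)] with n h1 h2 h3
        refine ae_of_all _ fun y => ENNReal.ofReal_le_ofReal ?_
        have := hFle n y
        have := hCle n h2 y
        have := hGq n y
        have := hτq y
        linarith)
      (by
        rw [setLIntegral_const]
        exact ENNReal.mul_ne_top ENNReal.ofReal_ne_top measure_ball_lt_top.ne)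
      (ae_of_all _ fun y => by
        have h1 : Tendsto (fun n => C n y * ρ n y - τ y) atTop (𝓝 ((τ y - 0) * 1 - τ y)) :=
          (((hG y).sub hqM).mul (hρ y)).sub_const _
        have h2 := ENNReal.tendsto_ofReal h1.abs
        simpa using h2)
    simpa using h
  -- The total contribution of the centring term up to distance `r n`; this is where `r² = o(M)`
  -- enters.
  have hball : Tendsto (fun n => ENNReal.ofReal (q n ^ 2 / M n) *
      volume (Metric.closedBall (0 : Plane) (r n))) atTop (𝓝 0) := by
    have h1 : Tendsto (fun n => q n ^ 2 * (r n ^ 2 / M n)) atTop (𝓝 (q₀ ^ 2 * 0)) :=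
      (hq.pow 2).mul hr.tendsto_div_nhds_zero
    have h2 := ENNReal.Tendsto.mul_const (b := volume (Metric.ball (0 : Plane) 1))
      (ENNReal.tendsto_ofReal h1) (Or.inr measure_ball_lt_top.ne)
    rw [mul_zero, ENNReal.ofReal_zero, zero_mul] at h2
    refine tendsto_of_tendsto_of_tendsto_of_le_of_le' tendsto_const_nhds h2
      (.of_forall fun _ => zero_le) ?_
    filter_upwards [hM.eventually_gt_atTop 0] with n hn
    calc _ ≤ ENNReal.ofReal (q n ^ 2 / M n) *
          (ENNReal.ofReal (r n ^ 2) * volume (Metric.ball (0 : Plane) 1)) := by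
          gcongr; exact volume_closedBall_zero_le _
      _ = _ := by
          rw [← mul_assoc, ← ENNReal.ofReal_mul (by positivity)]
          congr 2
          ring
  have htail := tendsto_setLIntegral_compl_ball hτm.ennreal_ofReal hτ
  have hL1 : Tendsto (fun n => ∫⁻ y, ENNReal.ofReal |C n y * ρ n y - τ y|) atTop (𝓝 0) := by
    rw [ENNReal.tendsto_nhds_zero]
    intro ε hε
    -- Five errors: the ball, `G` and the centring term in the middle zone, the far zone, and the
    -- tail of `τ`.
    have hε5 : 0 < ε / 5 := ENNReal.div_pos hε.ne' (by norm_num)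
    obtain ⟨k, hk1, hk2⟩ := ((htail.eventually_lt_const hε5).and
      (hmid.eventually_lt_const hε5)).exists
    filter_upwards [(hnear k).eventually_lt_const hε5, eventually_lt_of_limsup_lt hk2,
      hball.eventually_lt_const hε5, hfar.eventually_lt_const hε5, hM.eventually_ge_atTop 0]
      with n h1 h2 h3 h4 hMn
    set I : Set Plane := {y | (k : ℝ) ≤ ‖y‖ ∧ ‖y‖ ≤ r n} with hI
    set D : Set Plane := {y | r n ≤ ‖y‖}
    have hsub : (Metric.ball (0 : Plane) k)ᶜ ⊆ I ∪ D := fun y hy => by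
      have hy : (k : ℝ) ≤ ‖y‖ := by simpa using hy
      rcases le_total ‖y‖ (r n) with h | h
      · exact Or.inl ⟨hy, h⟩
      · exact Or.inr h
    have hIm : MeasurableSet I := (measurableSet_le measurable_const measurable_norm).inter
      (measurableSet_le measurable_norm measurable_const)
    have hmidC : ∫⁻ y in I, ENNReal.ofReal |C n y| ≤ ε / 5 + ε / 5 := by
      calc _ ≤ ∫⁻ y in I, (ENNReal.ofReal (G n y) + ENNReal.ofReal (q n ^ 2 / M n)) := by
            refine lintegral_mono fun y => ?_
            refine (ENNReal.ofReal_le_ofReal (hCle n hMn y)).trans ENNReal.ofReal_add_le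
        _ = (∫⁻ y in I, ENNReal.ofReal (G n y)) + ENNReal.ofReal (q n ^ 2 / M n) * volume I := by
            rw [lintegral_add_right _ measurable_const, setLIntegral_const]
        _ ≤ _ := by
            refine add_le_add h2.le (le_trans ?_ h3.le)
            gcongr
            exact fun y hy => by simpa using hy.2
    calc ∫⁻ y, ENNReal.ofReal |C n y * ρ n y - τ y|
        = (∫⁻ y in Metric.ball (0 : Plane) k, ENNReal.ofReal |C n y * ρ n y - τ y|) +
          ∫⁻ y in (Metric.ball (0 : Plane) k)ᶜ, ENNReal.ofReal |C n y * ρ n y - τ y| :=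
          (lintegral_add_compl _ Metric.isOpen_ball.measurableSet).symm
      _ ≤ ε / 5 + ∫⁻ y in (Metric.ball (0 : Plane) k)ᶜ,
          (ENNReal.ofReal |C n y| + ENNReal.ofReal (τ y)) := by
          refine add_le_add h1.le (lintegral_mono fun y => ?_)
          exact (ENNReal.ofReal_le_ofReal (hFle n y)).trans ENNReal.ofReal_add_le
      _ = ε / 5 + ((∫⁻ y in (Metric.ball (0 : Plane) k)ᶜ, ENNReal.ofReal |C n y|) +
          ∫⁻ y in (Metric.ball (0 : Plane) k)ᶜ, ENNReal.ofReal (τ y)) := by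
          rw [lintegral_add_right _ hτm.ennreal_ofReal]
      _ ≤ ε / 5 + ((ε / 5 + ε / 5 + ε / 5) + ε / 5) := by
          gcongr
          calc _ ≤ ∫⁻ y in I ∪ D, ENNReal.ofReal |C n y| := lintegral_mono_set hsub
            _ ≤ _ := lintegral_union_le _ _ _
            _ ≤ _ := add_le_add hmidC h4.le
      _ = (5 : ℝ≥0∞) * (ε / 5) := by ring
      _ = ε := ENNReal.mul_div_cancel (by norm_num) (by norm_num)
  refine tendsto_integral_of_L1 τ hτi.aestronglyMeasurable ?_ ?_
  · filter_upwards [hL1.eventually_lt_const one_pos] with n hn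
    have : Integrable fun y => C n y * ρ n y - τ y := by
      refine ⟨(hFm n).aestronglyMeasurable, ?_⟩
      rw [hasFiniteIntegral_iff_norm]
      exact hn.trans ENNReal.one_lt_top
    exact (this.add hτi).congr (ae_of_all _ fun y => by simp [hC])
  · simpa only [← ofReal_norm, Real.norm_eq_abs] using hL1

end

/-! ### Mean and variance of the window count; the mixing bound. -/

section

/-- Substitute `t = s + y` and integrate over `s` first. -/
lemma lintegral_lintegral_sub {S : Set Plane} (hS : MeasurableSet S) {g : Plane → ℝ≥0∞}
    (hg : Measurable g) :
    ∫⁻ s in S, ∫⁻ t in S, g (t - s) = ∫⁻ y, g y * volume (S ∩ {x | x + y ∈ S}) := by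
  have h1 : ∀ s, ∫⁻ t in S, g (t - s) = ∫⁻ y, S.indicator 1 (s + y) * g y := fun s => by
    rw [← lintegral_indicator hS, ← lintegral_add_left_eq_self _ s]
    refine lintegral_congr fun y => ?_
    by_cases h : s + y ∈ S <;> simp [h]
  have hind : Measurable (S.indicator (1 : Plane → ℝ≥0∞)) := measurable_one.indicator hS
  simp_rw [h1]
  rw [lintegral_lintegral_swap (by fun_prop)]
  refine lintegral_congr fun y => ?_
  rw [lintegral_mul_const _ (by fun_prop), mul_comm]
  congr 1
  have hm : MeasurableSet {x | x + y ∈ S} := (measurable_add_const y) hS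
  rw [show (fun s => S.indicator (1 : Plane → ℝ≥0∞) (s + y)) =
      {x | x + y ∈ S}.indicator 1 from rfl, lintegral_indicator_one hm,
    Measure.restrict_apply hm, Set.inter_comm]

lemma measurable_volume_inter_shift {S : Set Plane} (hS : MeasurableSet S) :
    Measurable fun y => volume (S ∩ {x | x + y ∈ S}) := by
  have : MeasurableSet {p : Plane × Plane | p.2 ∈ S ∧ p.2 + p.1 ∈ S} :=
    (measurable_snd hS).inter ((measurable_snd.add measurable_fst) hS)
  exact measurable_measure_prodMk_left this

lemma lintegral_volume_inter_shift {S : Set Plane} (hS : IsCompact S) :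
    ∫⁻ y, volume (S ∩ {x | x + y ∈ S}) = volume S * volume S := by
  have := lintegral_lintegral_sub hS.measurableSet (g := fun _ => 1) measurable_const
  rw [setLIntegral_const, setLIntegral_const, one_mul] at this
  simpa only [one_mul] using this.symm

lemma integrable_volume_inter_shift {S : Set Plane} (hS : IsCompact S) :
    Integrable fun y => volume.real (S ∩ {x | x + y ∈ S}) := by
  refine integrable_toReal_of_lintegral_ne_top
    (measurable_volume_inter_shift hS.measurableSet).aemeasurable ?_
  rw [lintegral_volume_inter_shift hS]
  exact ENNReal.mul_ne_top hS.measure_lt_top.ne hS.measure_lt_top.ne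

variable {Ω E : Type*} [mΩ : MeasurableSpace Ω] {P : Measure Ω} [MeasurableSpace E]
  {X : Plane → Ω → E}

namespace IsMeasurableField

lemma fieldSigma_le (hX : IsMeasurableField X) (S : Set Plane) : fieldSigma X S ≤ mΩ :=
  iSup₂_le fun s _ => (hX.measurable s).comap_le

/-- The σ-algebra of the field is kept on `Ω`, since the Campbell formulas need integrands
measurable for a σ-algebra independent of the process. -/
lemma measurable_indicator (hX : IsMeasurableField X) {B : Set E} (hB : MeasurableSet B) :
    Measurable[@Prod.instMeasurableSpace _ _ _ (fieldSigma X Set.univ)]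
      fun p : Plane × Ω => B.indicator (1 : E → ℝ≥0∞) (X p.1 p.2) :=
  (measurable_one.indicator hB).comp hX.joint

lemma measurable_indicator' (hX : IsMeasurableField X) {B : Set E} (hB : MeasurableSet B) :
    Measurable fun p : Plane × Ω => B.indicator (1 : E → ℝ≥0∞) (X p.1 p.2) :=
  (hX.measurable_indicator hB).mono
    (sup_le_sup le_rfl (MeasurableSpace.comap_mono (hX.fieldSigma_le _))) le_rfl

lemma lintegral_indicator_mul (hX : IsMeasurableField X) {B : Set E} (hB : MeasurableSet B)
    (s t : Plane) :
    ∫⁻ ω, B.indicator (1 : E → ℝ≥0∞) (X s ω) * B.indicator 1 (X t ω) ∂P =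
      P {ω | X s ω ∈ B ∧ X t ω ∈ B} := by
  rw [show {ω | X s ω ∈ B ∧ X t ω ∈ B} = X s ⁻¹' B ∩ X t ⁻¹' B from rfl,
    ← lintegral_indicator_one ((hX.measurable s hB).inter (hX.measurable t hB))]
  refine lintegral_congr fun ω => ?_
  by_cases h : X s ω ∈ B <;> by_cases h' : X t ω ∈ B <;> simp [h, h', Set.indicator]

lemma measurable_joint_exceedance [SFinite P] (hX : IsMeasurableField X) {B : Set E}
    (hB : MeasurableSet B) : Measurable fun y => P {ω | X 0 ω ∈ B ∧ X y ω ∈ B} := by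
  have h := hX.measurable_indicator' hB
  simp_rw [← hX.lintegral_indicator_mul hB]
  refine Measurable.lintegral_prod_right' (f := fun q : Plane × Ω =>
    B.indicator (1 : E → ℝ≥0∞) (X 0 q.2) * B.indicator 1 (X q.1 q.2)) ?_
  exact ((measurable_one.indicator hB).comp ((hX.measurable 0).comp measurable_snd)).mul h

end IsMeasurableField

lemma IsStationary.measure_mem (hst : IsStationary P X) (hm : ∀ s, Measurable (X s)) {B : Set E}
    (hB : MeasurableSet B) (s : Plane) : P {ω | X s ω ∈ B} = P {ω | X 0 ω ∈ B} := by
  have h := congrArg (fun η => η B) (hst.map_eq hm s)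
  simp only [Measure.map_apply (hm _) hB] at h
  exact h

lemma IsStationary.measure_mem_mem (hst : IsStationary P X) (hm : ∀ s, Measurable (X s))
    {B : Set E} (hB : MeasurableSet B) (s t : Plane) :
    P {ω | X s ω ∈ B ∧ X t ω ∈ B} = P {ω | X 0 ω ∈ B ∧ X (t - s) ω ∈ B} := by
  have h := congrArg (fun η => η (B ×ˢ B)) (hst.map_pair hm s t)
  simp only [Measure.map_apply ((hm _).prodMk (hm _)) (hB.prod hB)] at h
  exact h

/-- The number of sampling locations in the window `S` at which the field lies in `B`. -/
noncomputable def windowCount (X : Plane → Ω → E) (N : Ω → Measure Plane) (S : Set Plane)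
    (B : Set E) (ω : Ω) : ℝ≥0∞ :=
  ∫⁻ s in S, B.indicator 1 (X s ω) ∂(N ω)

section WindowCount

variable {N : Ω → Measure Plane} {ν : ℝ≥0} {S : Set Plane} {B : Set E}

lemma measurable_windowCount (hX : IsMeasurableField X) (hN : IsPoissonProcess P N ν)
    (hS : IsCompact S) (hB : MeasurableSet B) : Measurable (windowCount X N S B) := by
  have := hN.isSFiniteKernel_windowKernel hS.measurableSet hS.isBounded
  exact Measurable.lintegral_kernel_prod_right (κ := hN.windowKernel hS.measurableSet)
    (f := fun ω s => B.indicator 1 (X s ω)) ((hX.measurable_indicator' hB).comp measurable_swap)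

omit [MeasurableSpace E] in
lemma windowCount_lt_top (hN : IsPoissonProcess P N ν) (hS : IsCompact S) (ω : Ω) :
    windowCount X N S B ω < ∞ := by
  have := hN.isFiniteMeasure_restrict hS.measurableSet hS.isBounded ω
  refine (lintegral_mono (g := fun _ => 1) fun s => ?_).trans_lt (by
    simpa using measure_lt_top ((N ω).restrict S) Set.univ)
  exact Set.indicator_le_self' (fun _ _ => zero_le) _

variable [IsProbabilityMeasure P]

lemma lintegral_windowCount (hX : IsMeasurableField X) (hst : IsStationary P X)
    (hN : IsPoissonProcess P N ν)
    (hind : Indep (fieldSigma X Set.univ) (MeasurableSpace.comap N inferInstance) P)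
    (hS : IsCompact S) (hB : MeasurableSet B) :
    ∫⁻ ω, windowCount X N S B ω ∂P = ν * (P {ω | X 0 ω ∈ B} * volume S) := by
  simp only [windowCount]
  rw [hN.lintegral_window (hX.fieldSigma_le _) hind hS.measurableSet hS.isBounded
    (hX.measurable_indicator hB)]
  congr 1
  have : ∀ s, ∫⁻ ω, B.indicator (1 : E → ℝ≥0∞) (X s ω) ∂P = P {ω | X 0 ω ∈ B} := fun s => by
    rw [← hst.measure_mem hX.measurable hB s]
    exact lintegral_indicator_one (hX.measurable s hB)
  simp_rw [this, setLIntegral_const]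

lemma lintegral_windowCount_sq (hX : IsMeasurableField X) (hst : IsStationary P X)
    (hN : IsPoissonProcess P N ν)
    (hind : Indep (fieldSigma X Set.univ) (MeasurableSpace.comap N inferInstance) P)
    (hS : IsCompact S) (hB : MeasurableSet B) :
    ∫⁻ ω, windowCount X N S B ω ^ 2 ∂P =
      ν ^ 2 * (∫⁻ y, P {ω | X 0 ω ∈ B ∧ X y ω ∈ B} * volume (S ∩ {x | x + y ∈ S})) +
        ν * (P {ω | X 0 ω ∈ B} * volume S) := by
  simp only [windowCount]
  rw [hN.lintegral_window_sq (hX.fieldSigma_le _) hind hS.measurableSet hS.isBounded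
    (hX.measurable_indicator hB)]
  congr 2
  · have : ∀ s t, ∫⁻ ω, B.indicator (1 : E → ℝ≥0∞) (X s ω) * B.indicator 1 (X t ω) ∂P =
        P {ω | X 0 ω ∈ B ∧ X (t - s) ω ∈ B} := fun s t =>
      (hX.lintegral_indicator_mul hB s t).trans (hst.measure_mem_mem hX.measurable hB s t)
    simp_rw [this]
    exact lintegral_lintegral_sub hS.measurableSet (hX.measurable_joint_exceedance hB)
  · have : ∀ s, ∫⁻ ω, B.indicator (1 : E → ℝ≥0∞) (X s ω) ^ 2 ∂P = P {ω | X 0 ω ∈ B} := fun s => by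
      simp_rw [sq, hX.lintegral_indicator_mul hB, and_self]
      exact hst.measure_mem hX.measurable hB s
    simp_rw [this, setLIntegral_const]

lemma lintegral_windowCount_sq_ne_top (hX : IsMeasurableField X) (hst : IsStationary P X)
    (hN : IsPoissonProcess P N ν)
    (hind : Indep (fieldSigma X Set.univ) (MeasurableSpace.comap N inferInstance) P)
    (hS : IsCompact S) (hB : MeasurableSet B) :
    ∫⁻ ω, windowCount X N S B ω ^ 2 ∂P ≠ ∞ := by
  have h : ∫⁻ y, P {ω | X 0 ω ∈ B ∧ X y ω ∈ B} * volume (S ∩ {x | x + y ∈ S}) ≠ ∞ := by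
    refine ne_top_of_le_ne_top (b := volume S * volume S)
      (ENNReal.mul_ne_top hS.measure_lt_top.ne hS.measure_lt_top.ne) ?_
    rw [← lintegral_volume_inter_shift hS]
    exact lintegral_mono fun y => mul_le_of_le_one_left zero_le prob_le_one
  rw [lintegral_windowCount_sq hX hst hN hind hS hB]
  exact ENNReal.add_ne_top.2 ⟨ENNReal.mul_ne_top (ENNReal.pow_ne_top ENNReal.coe_ne_top) h,
    ENNReal.mul_ne_top ENNReal.coe_ne_top (ENNReal.mul_ne_top (measure_ne_top _ _) hS.measure_lt_top.ne)⟩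

lemma memLp_windowCount (hX : IsMeasurableField X) (hst : IsStationary P X)
    (hN : IsPoissonProcess P N ν)
    (hind : Indep (fieldSigma X Set.univ) (MeasurableSpace.comap N inferInstance) P)
    (hS : IsCompact S) (hB : MeasurableSet B) :
    MemLp (fun ω => (windowCount X N S B ω).toReal) 2 P := by
  have hm := measurable_windowCount hX hN hS hB
  rw [memLp_two_iff_integrable_sq hm.ennreal_toReal.aestronglyMeasurable]
  have := integrable_toReal_of_lintegral_ne_top (hm.pow_const 2).aemeasurable
    (lintegral_windowCount_sq_ne_top hX hst hN hind hS hB)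
  simpa only [ENNReal.toReal_pow] using this

lemma integral_windowCount (hX : IsMeasurableField X) (hst : IsStationary P X)
    (hN : IsPoissonProcess P N ν)
    (hind : Indep (fieldSigma X Set.univ) (MeasurableSpace.comap N inferInstance) P)
    (hS : IsCompact S) (hB : MeasurableSet B) :
    ∫ ω, (windowCount X N S B ω).toReal ∂P = ν * (P.real {ω | X 0 ω ∈ B} * volume.real S) := by
  rw [integral_toReal (measurable_windowCount hX hN hS hB).aemeasurable
    (ae_of_all _ (windowCount_lt_top hN hS)), lintegral_windowCount hX hst hN hind hS hB]
  simp [measureReal_def]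

/-- Since `∫ |S ∩ (S - y)| dy = |S|²`, the squared mean can be absorbed into the integral, where it
turns joint probabilities into covariances. -/
lemma variance_windowCount (hX : IsMeasurableField X) (hst : IsStationary P X)
    (hN : IsPoissonProcess P N ν)
    (hind : Indep (fieldSigma X Set.univ) (MeasurableSpace.comap N inferInstance) P)
    (hS : IsCompact S) (hB : MeasurableSet B) :
    variance (fun ω => (windowCount X N S B ω).toReal) P =
      ν ^ 2 * (∫ y, (P.real {ω | X 0 ω ∈ B ∧ X y ω ∈ B} - P.real {ω | X 0 ω ∈ B} ^ 2) *
        volume.real (S ∩ {x | x + y ∈ S})) + ν * (P.real {ω | X 0 ω ∈ B} * volume.real S) := by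
  have hm := measurable_windowCount hX hN hS hB
  have hvm := measurable_volume_inter_shift hS.measurableSet
  have hgm := hX.measurable_joint_exceedance (P := P) hB
  have hvi := integrable_volume_inter_shift hS
  have hv : ∫ y, volume.real (S ∩ {x | x + y ∈ S}) = volume.real S ^ 2 := by
    simp only [measureReal_def]
    rw [integral_toReal hvm.aemeasurable (ae_of_all _ fun y =>
      (measure_mono Set.inter_subset_left).trans_lt hS.measure_lt_top),
      lintegral_volume_inter_shift hS, ENNReal.toReal_mul, sq]
  have hgi : Integrable fun y => P.real {ω | X 0 ω ∈ B ∧ X y ω ∈ B} *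
      volume.real (S ∩ {x | x + y ∈ S}) :=
    hvi.bdd_mul (c := 1) hgm.ennreal_toReal.aestronglyMeasurable (ae_of_all _ fun y => by
      rw [Real.norm_of_nonneg measureReal_nonneg]; exact measureReal_le_one)
  have hsq : ∫ ω, (windowCount X N S B ω).toReal ^ 2 ∂P =
      ν ^ 2 * (∫ y, P.real {ω | X 0 ω ∈ B ∧ X y ω ∈ B} * volume.real (S ∩ {x | x + y ∈ S})) +
        ν * (P.real {ω | X 0 ω ∈ B} * volume.real S) := by
    have hne := lintegral_windowCount_sq_ne_top hX hst hN hind hS hB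
    simp only [← ENNReal.toReal_pow]
    rw [integral_toReal (hm.pow_const 2).aemeasurable (ae_of_all _ fun ω =>
      ENNReal.pow_lt_top (windowCount_lt_top hN hS ω))]
    rw [lintegral_windowCount_sq hX hst hN hind hS hB] at hne ⊢
    rw [ENNReal.toReal_add (ENNReal.add_ne_top.1 hne).1 (ENNReal.add_ne_top.1 hne).2]
    simp only [ENNReal.toReal_mul, ENNReal.toReal_pow, ENNReal.coe_toReal, measureReal_def]
    congr 2
    simp only [← ENNReal.toReal_mul]
    exact (integral_toReal (hgm.mul hvm).aemeasurable (ae_of_all _ fun y =>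
      ENNReal.mul_lt_top (measure_lt_top _ _)
        ((measure_mono Set.inter_subset_left).trans_lt hS.measure_lt_top))).symm
  rw [variance_eq_sub (memLp_windowCount hX hst hN hind hS hB)]
  simp only [Pi.pow_apply]
  rw [hsq, integral_windowCount hX hst hN hind hS hB]
  simp only [sub_mul]
  rw [integral_sub hgi (hvi.const_mul _), integral_const_mul, hv]
  ring

end WindowCount

lemma IsStationary.abs_sub_le_mixingCoeff [IsProbabilityMeasure P] (hst : IsStationary P X)
    (hm : ∀ s, Measurable (X s)) {B : Set E} (hB : MeasurableSet B) (y : Plane) :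
    |P.real {ω | X 0 ω ∈ B ∧ X y ω ∈ B} - P.real {ω | X 0 ω ∈ B} ^ 2| ≤
      mixingCoeff P X 1 1 ‖y‖ := by
  -- The bound 1 is needed because a real `sSup` dominates the elements only of a bounded set.
  refine le_csSup ⟨1, ?_⟩ ⟨{0}, {y}, by simp, by simp, by simp, {ω | X 0 ω ∈ B},
    {ω | X y ω ∈ B}, ?_, ?_, ?_⟩
  · rintro x ⟨S, T, -, -, -, U, V, -, -, rfl⟩
    have h1 : P.real (U ∩ V) ≤ 1 := measureReal_le_one
    have h2 : P.real U * P.real V ≤ 1 :=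
      mul_le_one₀ measureReal_le_one measureReal_nonneg measureReal_le_one
    have h3 : 0 ≤ P.real U * P.real V := mul_nonneg measureReal_nonneg measureReal_nonneg
    have h4 : 0 ≤ P.real (U ∩ V) := measureReal_nonneg
    exact abs_le.2 ⟨by linarith, by linarith⟩
  · have : MeasurableSpace.comap (X 0) inferInstance ≤ fieldSigma X ({0} : Finset Plane) :=
      le_iSup₂_of_le 0 (by simp) le_rfl
    exact this _ ⟨B, hB, rfl⟩
  · have : MeasurableSpace.comap (X y) inferInstance ≤ fieldSigma X ({y} : Finset Plane) :=
      le_iSup₂_of_le y (by simp) le_rfl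
    exact this _ ⟨B, hB, rfl⟩
  · have : P.real {ω | X y ω ∈ B} = P.real {ω | X 0 ω ∈ B} := by
      rw [measureReal_def, hst.measure_mem hm hB y, measureReal_def]
    rw [this, sq]
    rfl

end

/-! ### The estimator. -/

section

variable {Ω E : Type*} [mΩ : MeasurableSpace Ω] {P : Measure Ω} [NormedAddCommGroup E]
  [NormedSpace ℝ E] [MeasurableSpace E] [BorelSpace E]
  {X : Plane → Ω → E} {N : Ω → Measure Plane} {ν : ℝ≥0} {S : Set Plane} {A : Set E}

lemma measurableSet_preimage_inv_smul (hA : MeasurableSet A) (c : ℝ) :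
    MeasurableSet ((fun x : E => c⁻¹ • x) ⁻¹' A) :=
  (continuous_const_smul c⁻¹).measurable hA

lemma pHat_eq (hX : IsMeasurableField X) (hA : MeasurableSet A) (a : ℕ → ℝ)
    (m : ℕ) : pHat X N ν a A S m = fun ω => (m : ℝ) / (ν * volume.real S) *
      (windowCount X N S ((fun x : E => (a m)⁻¹ • x) ⁻¹' A) ω).toReal := by
  have hB := measurableSet_preimage_inv_smul hA (a m)
  funext ω
  simp only [pHat, windowCount]
  congr 1
  rw [integral_eq_lintegral_of_nonneg_ae (ae_of_all _ fun s =>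
    Set.indicator_nonneg (fun _ _ => zero_le_one) _)]
  · congr 1
    refine lintegral_congr fun s => ?_
    by_cases h : (a m)⁻¹ • X s ω ∈ A <;> simp [Set.indicator, h]
  · have h1 := ((hX.measurable_indicator' hB).comp
      (measurable_prodMk_right (y := ω))).ennreal_toReal
    refine Measurable.aestronglyMeasurable ?_
    convert h1 using 2 with s
    by_cases h : (a m)⁻¹ • X s ω ∈ A <;> simp [Set.indicator, h]

variable [IsProbabilityMeasure P]

lemma memLp_pHat (hX : IsMeasurableField X) (hst : IsStationary P X)
    (hN : IsPoissonProcess P N ν)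
    (hind : Indep (fieldSigma X Set.univ) (MeasurableSpace.comap N inferInstance) P)
    (hS : IsCompact S) (hA : MeasurableSet A) (a : ℕ → ℝ) (m : ℕ) :
    MemLp (pHat X N ν a A S m) 2 P := by
  rw [pHat_eq hX hA]
  exact (memLp_windowCount hX hst hN hind hS (measurableSet_preimage_inv_smul hA _)).const_mul _

lemma integral_pHat (hX : IsMeasurableField X) (hst : IsStationary P X)
    (hN : IsPoissonProcess P N ν) (hν : 0 < ν)
    (hind : Indep (fieldSigma X Set.univ) (MeasurableSpace.comap N inferInstance) P)
    (hS : IsCompact S) (hpos : 0 < volume.real S) (hA : MeasurableSet A) (a : ℕ → ℝ) (m : ℕ) :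
    ∫ ω, pHat X N ν a A S m ω ∂P = pPre P X a A m := by
  have hν' : (0 : ℝ) < ν := hν
  rw [pHat_eq hX hA, integral_const_mul,
    integral_windowCount hX hst hN hind hS (measurableSet_preimage_inv_smul hA _), pPre]
  simp only [Set.mem_preimage]
  field_simp

/-- The total factor is `|S|/m · (m/(ν|S|))² = m/(ν²|S|)`: the covariance term keeps `m/|S|`, and
the diagonal term becomes `m p / ν`. -/
lemma variance_pHat (hX : IsMeasurableField X) (hst : IsStationary P X)
    (hN : IsPoissonProcess P N ν) (hν : 0 < ν)
    (hind : Indep (fieldSigma X Set.univ) (MeasurableSpace.comap N inferInstance) P)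
    (hS : IsCompact S) (hpos : 0 < volume.real S) (hA : MeasurableSet A) (a : ℕ → ℝ) {m : ℕ}
    (hm : 0 < m) :
    volume.real S / m * variance (pHat X N ν a A S m) P =
      pPre P X a A m / ν + ∫ y, (tauPre P X a A A m y - pPre P X a A m ^ 2 / m) *
        (volume.real (S ∩ {x | x + y ∈ S}) / volume.real S) := by
  have hν' : (0 : ℝ) < ν := hν
  have hm' : (0 : ℝ) < m := by exact_mod_cast hm
  rw [pHat_eq hX hA, variance_const_mul,
    variance_windowCount hX hst hN hind hS (measurableSet_preimage_inv_smul hA _)]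
  simp only [Set.mem_preimage, pPre, tauPre]
  set p := P.real {ω | (a m)⁻¹ • X 0 ω ∈ A}
  have : ∀ y, (m * P.real {ω | (a m)⁻¹ • X 0 ω ∈ A ∧ (a m)⁻¹ • X y ω ∈ A} - (m * p) ^ 2 / m) *
      (volume.real (S ∩ {x | x + y ∈ S}) / volume.real S) = m / volume.real S *
      ((P.real {ω | (a m)⁻¹ • X 0 ω ∈ A ∧ (a m)⁻¹ • X y ω ∈ A} - p ^ 2) *
        volume.real (S ∩ {x | x + y ∈ S})) := fun y => by field_simp
  simp_rw [this]
  rw [integral_const_mul]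
  field_simp
  ring

omit [IsProbabilityMeasure P] [MeasurableSpace E] [BorelSpace E] in
/-- Joint exceedances of a set bounded away from zero are joint exceedances of the norm. -/
lemma tendsto_limsup_tauPre {a : ℕ → ℝ} {m : ℕ → ℕ} {r : ℕ → ℝ} (hA0 : (0 : E) ∉ closure A)
    [IsFiniteMeasure P] (ha : Tendsto a atTop atTop) (hm : Tendsto m atTop atTop)
    (h : ∀ ε : ℝ, 0 < ε →
      Tendsto (fun k : ℕ => limsup (fun n : ℕ =>
        ∫⁻ y in {y : Plane | (k : ℝ) ≤ ‖y‖ ∧ ‖y‖ ≤ r n},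
          (m n : ℝ≥0∞) * P {ω | ε * a (m n) < ‖X y ω‖ ∧ ε * a (m n) < ‖X 0 ω‖}) atTop)
        atTop (𝓝 0)) :
    Tendsto (fun k : ℕ => limsup (fun n : ℕ =>
      ∫⁻ y in {y : Plane | (k : ℝ) ≤ ‖y‖ ∧ ‖y‖ ≤ r n},
        ENNReal.ofReal (tauPre P X a A A (m n) y)) atTop) atTop (𝓝 0) := by
  obtain ⟨ρ, hρ, hρA⟩ := Metric.nhds_basis_ball.mem_iff.1
    (isClosed_closure.isOpen_compl.mem_nhds hA0 : (closure A)ᶜ ∈ 𝓝 0)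
  -- Halving `ρ` makes the inequality strict, as in the anticlustering condition.
  have hex : ∀ c : ℝ, 0 < c → ∀ x : E, c⁻¹ • x ∈ A → ρ / 2 * c < ‖x‖ := by
    intro c hc x hx
    have h1 : ρ ≤ ‖c⁻¹ • x‖ := by
      by_contra hlt
      exact hρA (mem_ball_zero_iff.2 (not_le.1 hlt)) (subset_closure hx)
    rw [norm_smul, norm_inv, Real.norm_of_nonneg hc.le, inv_mul_eq_div, le_div_iff₀ hc] at h1
    nlinarith
  refine tendsto_of_tendsto_of_tendsto_of_le_of_le tendsto_const_nhds (h (ρ / 2) (by positivity))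
    (fun _ => zero_le) fun k => limsup_le_limsup ?_
  filter_upwards [(ha.comp hm).eventually_gt_atTop 0] with n hn
  refine lintegral_mono fun y => ?_
  rw [tauPre, ENNReal.ofReal_mul (Nat.cast_nonneg _), ofReal_measureReal, ENNReal.ofReal_natCast]
  exact mul_le_mul' le_rfl (measure_mono fun ω hω => ⟨hex _ hn _ hω.2, hex _ hn _ hω.1⟩)

lemma abs_tauPre_sub_le (hX : IsMeasurableField X) (hst : IsStationary P X)
    (hA : MeasurableSet A) (a : ℕ → ℝ) (m : ℕ) (y : Plane) :
    |tauPre P X a A A m y - pPre P X a A m ^ 2 / m| ≤ m * mixingCoeff P X 1 1 ‖y‖ := by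
  have h := hst.abs_sub_le_mixingCoeff hX.measurable (measurableSet_preimage_inv_smul hA (a m)) y
  simp only [Set.mem_preimage] at h
  rcases Nat.eq_zero_or_pos m with rfl | hm
  · simp [tauPre]
  have hm' : (0 : ℝ) < m := by exact_mod_cast hm
  rw [tauPre, pPre, mul_pow, sq (m : ℝ), mul_assoc, mul_div_cancel_left₀ _ hm'.ne', ← mul_sub,
    abs_mul, abs_of_pos hm']
  gcongr

/-- Chebyshev: vanishing variance and convergent means give convergence in probability. -/
lemma tendstoInMeasure_of_variance_tendsto_zero {Ω : Type*} [MeasurableSpace Ω] {P : Measure Ω}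
    [IsProbabilityMeasure P] {Z : ℕ → Ω → ℝ} {c : ℝ} (hZ : ∀ n, MemLp (Z n) 2 P)
    (hvar : Tendsto (fun n => variance (Z n) P) atTop (𝓝 0))
    (hmean : Tendsto (fun n => ∫ ω, Z n ω ∂P) atTop (𝓝 c)) :
    TendstoInMeasure P Z atTop fun _ => c := by
  rw [tendstoInMeasure_iff_norm]
  intro ε hε
  have h1 : Tendsto (fun n => ENNReal.ofReal (variance (Z n) P / (ε / 2) ^ 2)) atTop (𝓝 0) := by
    have := ENNReal.tendsto_ofReal (hvar.div_const ((ε / 2) ^ 2))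
    simpa using this
  refine tendsto_of_tendsto_of_tendsto_of_le_of_le' tendsto_const_nhds h1
    (.of_forall fun _ => zero_le) ?_
  filter_upwards [Metric.tendsto_nhds.1 hmean (ε / 2) (by positivity)] with n hn
  refine (measure_mono fun ω hω => ?_).trans (meas_ge_le_variance_div_sq (hZ n) (half_pos hε))
  simp only [Set.mem_ofPred_eq, Real.norm_eq_abs, Real.dist_eq] at *
  have := abs_sub_le (Z n ω) (∫ ω, Z n ω ∂P) c
  linarith

end

end SpatialExtremogram

/-! ### Assembly of the main theorem. -/

open SpatialExtremogram in
theorem mainTheorem4 {Ω E : Type*} [MeasurableSpace Ω] (P : Measure Ω) [IsProbabilityMeasure P]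
    [NormedAddCommGroup E] [NormedSpace ℝ E] [FiniteDimensional ℝ E] [MeasurableSpace E]
    [BorelSpace E]
    -- the random field, its normalization and its limit measures
    (X : SpatialExtremogram.Plane → Ω → E) (α : ℝ) (a : ℕ → ℝ)
    (μ : (H : Finset SpatialExtremogram.Plane) → Measure (H → E))
    (hXmeas : SpatialExtremogram.IsMeasurableField X)
    (hXstat : SpatialExtremogram.IsStationary P X)
    (hXrv : SpatialExtremogram.IsRegularlyVarying P X α a μ)
    (ha : Tendsto (fun n : ℕ => (n : ℝ) * P.real {ω | a n < ‖X 0 ω‖}) atTop (𝓝 1))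
    -- the Poisson process of sampling locations, independent of the field
    (N : Ω → Measure SpatialExtremogram.Plane) (ν : ℝ≥0) (hν : 0 < ν)
    (hN : SpatialExtremogram.IsPoissonProcess P N ν)
    (hindep : Indep (SpatialExtremogram.fieldSigma X Set.univ)
      (MeasurableSpace.comap N inferInstance) P)
    -- the observation windows
    (S : ℕ → Set SpatialExtremogram.Plane)
    (hScompact : ∀ n, IsCompact (S n)) (hSconvex : ∀ n, Convex ℝ (S n))
    (hSvol : Tendsto (fun n => volume.real (S n)) atTop atTop)
    (hSshift : ∀ y : SpatialExtremogram.Plane,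
      Tendsto (fun n => volume.real (S n ∩ {x | x + y ∈ S n}) / volume.real (S n)) atTop (𝓝 1))
    -- the set `A`: Borel, bounded away from zero, and a continuity set of the limit measure
    (A : Set E) (hA : MeasurableSet A) (hA0 : (0 : E) ∉ closure A)
    (hAcont : SpatialExtremogram.oneSite μ (frontier A) = 0)
    -- condition (M2)
    (m : ℕ → ℕ) (r : ℕ → ℝ) (hm : Tendsto m atTop atTop)
    (hM2 : SpatialExtremogram.ConditionM2 P X a m r A) :
    (∀ n, MemLp (SpatialExtremogram.pHat X N ν a A (S n) (m n)) 2 P) ∧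
    (∀ n, 0 < volume.real (S n) →
      ∫ ω, SpatialExtremogram.pHat X N ν a A (S n) (m n) ω ∂P =
        SpatialExtremogram.pPre P X a A (m n)) ∧
    Tendsto (fun n => SpatialExtremogram.pPre P X a A (m n)) atTop
      (𝓝 ((SpatialExtremogram.oneSite μ).real A)) ∧
    Tendsto (fun n => volume.real (S n) / (m n : ℝ) *
        variance (SpatialExtremogram.pHat X N ν a A (S n) (m n)) P) atTop
      (𝓝 ((SpatialExtremogram.oneSite μ).real A / (ν : ℝ) +
        ∫ y : SpatialExtremogram.Plane, SpatialExtremogram.tau P X a m A A y)) ∧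
    ((fun n => (m n : ℝ)) =o[atTop] (fun n => volume.real (S n)) →
      TendstoInMeasure P (fun n => SpatialExtremogram.pHat X N ν a A (S n) (m n)) atTop
        (fun _ => (SpatialExtremogram.oneSite μ).real A)) := by
  -- Properness supplies the second countability of `E` used for regular variation.
  have hprop : ProperSpace E := FiniteDimensional.proper ℝ E
  have hmX := hXmeas.measurable
  have hpm := (hXrv.tendsto_pPre hmX hA hA0 hAcont).comp hm
  have hvar : Tendsto (fun n => volume.real (S n) / (m n : ℝ) *
      variance (SpatialExtremogram.pHat X N ν a A (S n) (m n)) P) atTop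
      (𝓝 ((SpatialExtremogram.oneSite μ).real A / (ν : ℝ) + ∫ y : SpatialExtremogram.Plane, SpatialExtremogram.tau P X a m A A y)) := by
    have hcov := SpatialExtremogram.tendsto_integral_covariance (G := fun n y => SpatialExtremogram.tauPre P X a A A (m n) y)
      (ρ := fun n y => volume.real (S n ∩ {x | x + y ∈ S n}) / volume.real (S n))
      (q := fun n => SpatialExtremogram.pPre P X a A (m n)) (M := fun n => (m n : ℝ)) (r := r)
      (fun n => ((hXmeas.measurable_joint_exceedance
        (SpatialExtremogram.measurableSet_preimage_inv_smul hA (a (m n)))).ennreal_toReal.const_mul _))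
      (fun n y => mul_nonneg (Nat.cast_nonneg _) measureReal_nonneg)
      (fun n y => mul_le_mul_of_nonneg_left (measureReal_mono fun ω hω => hω.1)
        (Nat.cast_nonneg _))
      (fun n => (SpatialExtremogram.measurable_volume_inter_shift
        (hScompact n).measurableSet).ennreal_toReal.div_const _)
      (fun n y => div_nonneg measureReal_nonneg measureReal_nonneg)
      (fun n y => div_le_one_of_le₀ (measureReal_mono Set.inter_subset_left
        (hScompact n).measure_lt_top.ne) measureReal_nonneg)
      hpm (tendsto_natCast_atTop_atTop.comp hm) hM2.r_littleO
      (hXrv.tendsto_tau hXstat hmX hA hA0 hAcont hm) hSshift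
      (SpatialExtremogram.tendsto_limsup_tauPre hA0 hXrv.tendsto_norm hm hM2.anticlustering)
      (tendsto_of_tendsto_of_tendsto_of_le_of_le tendsto_const_nhds hM2.mixing
        (fun _ => zero_le) fun n => lintegral_mono fun y => by
          rw [← ENNReal.ofReal_natCast, ← ENNReal.ofReal_mul (Nat.cast_nonneg _)]
          exact ENNReal.ofReal_le_ofReal (SpatialExtremogram.abs_tauPre_sub_le hXmeas hXstat hA a (m n) y))
      hM2.tau_integral
    refine ((hpm.div_const (ν : ℝ)).add hcov).congr' ?_
    filter_upwards [hSvol.eventually_gt_atTop 0, hm.eventually_gt_atTop 0] with n h1 h2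
    exact (SpatialExtremogram.variance_pHat hXmeas hXstat hN hν hindep (hScompact n) h1 hA a h2).symm
  have hmem := fun n => SpatialExtremogram.memLp_pHat hXmeas hXstat hN hindep (hScompact n) hA a (m n)
  have hmean := fun n (h : 0 < volume.real (S n)) =>
    SpatialExtremogram.integral_pHat hXmeas hXstat hN hν hindep (hScompact n) h hA a (m n)
  refine ⟨hmem, hmean, hpm, hvar, fun ho => ?_⟩
  have hvar0 : Tendsto (fun n => variance (SpatialExtremogram.pHat X N ν a A (S n) (m n)) P) atTop (𝓝 0) := by
    -- The variance is `m/|S|` times its normalized version, which converges.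
    have h := ho.tendsto_div_nhds_zero.mul hvar
    rw [zero_mul] at h
    refine h.congr' ?_
    filter_upwards [hSvol.eventually_gt_atTop 0, hm.eventually_gt_atTop 0] with n h1 h2
    have h2' : (0 : ℝ) < m n := by exact_mod_cast h2
    field_simp
  exact SpatialExtremogram.tendstoInMeasure_of_variance_tendsto_zero hmem hvar0 (hpm.congr' (by
    filter_upwards [hSvol.eventually_gt_atTop 0] with n h1 using (hmean n h1).symm))
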